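/- Let $(M,g)$ be a connected smooth pseudo-Riemannian manifold of dimension $n\ge 4$ whose Weyl conformal tensor $W$ (viewed as a four-times covariant tensor) is parallel, $\nabla W=0$, for the Levi-Civita connection $\nabla$. For $x\in M$ let $$\mathcal D_x=\{u\in T_xM:\ g_x(u,\cdot)\wedge W_x(v,v',\cdot,\cdot)=0\ \text{ for all } v,v'\in T_xM\}$$ be the fibre at $x$ of the Olszak distribution $\mathcal D$, and let $d$ denote the dimension of $\mathcal D$. By a parallel $2$-form defined up to a sign we mean a family of pairs $\{\omega_x,-\omega_x\}$ of $2$-forms $\omega_x$ on $T_xM$, $x\in M$, such that every point of $M$ has a neighborhood $U$ with a smooth parallel $2$-form $\eta$ on $U$ satisfying $\eta_x=\pm\omega_x$ for all $x\in U$. (a) One has $d=2$ (that is, $\dim\mathcal D_x=2$ for every $x\in M$) if and only if, for some sign $\varepsilon\in\{1,-1\}$ and some parallel $2$-form $\omega$ defined up to a sign and having rank $2$ at every point, $W=\varepsilon\,\omega\otimes\omega$ on $M$, that is, $W_x(u,v,w,z)=\varepsilon\,\omega_x(u,v)\,\omega_x(w,z)$ for all $x\in M$ and $u,v,w,z\in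 T_xM$. (b) For any $\varepsilon$ and $\omega$ as in (a), the image of $\omega_x$ (identified through $g_x$ with an endomorphism of $T_xM$) is equal to $\mathcal D_x$ at every $x\in M$. Furthermore, $\varepsilon$ is unique, and $\omega_x$ is unique up to a sign at every $x\in M$. -/

import Mathlib

open scoped Manifold ContDiff

noncomputable section

/-- The coordinate space `ℝⁿ`. -/
abbrev Coord (n : ℕ) : Type := EuclideanSpace ℝ (Fin n)

/-! ### Tensor calculus on `ℝⁿ`

`G` is a field of symmetric nondegenerate bilinear forms, defined on an open set of `ℝⁿ`: the
components of a metric in a coordinate chart. -/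

namespace LocalMetric

variable {n : ℕ}

/-- The coordinate vector `∂ᵢ`. -/
def basisVec (i : Fin n) : Coord n := EuclideanSpace.single i (1 : ℝ)

/-- The vector metrically equivalent to a covector: `g (sharp ξ, ·) = ξ`. -/
def sharp (G : Coord n → Coord n →L[ℝ] Coord n →L[ℝ] ℝ) (y : Coord n) (ξ : Coord n →L[ℝ] ℝ) :
    Coord n :=
  (G y).inverse ξ

/-- The Christoffel symbols of the Levi-Civita connection: `Γ(u, v)` is the vector with
`2 g(Γ(u, v), w) = (∂ᵤ g)(v, w) + (∂ᵥ g)(u, w) - (∂_w g)(u, v)`. For constant `u, v` on `ℝⁿ`,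
`Γ(u, v) = ∇ᵤ v`. -/
def christoffel (G : Coord n → Coord n →L[ℝ] Coord n →L[ℝ] ℝ) (y u v : Coord n) : Coord n :=
  sharp G y ((1 / 2 : ℝ) •
    (fderiv ℝ G y u v + fderiv ℝ G y v u - ((fderiv ℝ G y).flip u).flip v))

/-- The curvature operator `R(u, v) w = ∇ᵤ ∇ᵥ w - ∇ᵥ ∇ᵤ w` (constant fields `u, v, w`). -/
def curvature (G : Coord n → Coord n →L[ℝ] Coord n →L[ℝ] ℝ) (y u v w : Coord n) : Coord n :=
  fderiv ℝ (fun z ↦ christoffel G z v w) y u - fderiv ℝ (fun z ↦ christoffel G z u w) y v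
    + christoffel G y u (christoffel G y v w) - christoffel G y v (christoffel G y u w)

/-- The Ricci tensor `ρ(v, w) = trace (u ↦ R(u, v) w)`. -/
def ricci (G : Coord n → Coord n →L[ℝ] Coord n →L[ℝ] ℝ) (y v w : Coord n) : ℝ :=
  ∑ i : Fin n, curvature G y (basisVec i) v w i

/-- The scalar curvature `s = gⁱʲ ρᵢⱼ`. -/
def scalar (G : Coord n → Coord n →L[ℝ] Coord n →L[ℝ] ℝ) (y : Coord n) : ℝ :=
  ∑ i : Fin n, ∑ j : Fin n,
    sharp G y (EuclideanSpace.proj j) i * ricci G y (basisVec i) (basisVec j)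

/-- The Weyl conformal tensor (dimension `n ≥ 3`), as a four-times covariant tensor. -/
def weyl (G : Coord n → Coord n →L[ℝ] Coord n →L[ℝ] ℝ) (y u v w z : Coord n) : ℝ :=
  G y (curvature G y u v w) z
    - (1 / ((n : ℝ) - 2)) *
      (ricci G y v w * G y u z - ricci G y u w * G y v z
        + G y v w * ricci G y u z - G y u w * ricci G y v z)
    + (scalar G y / (((n : ℝ) - 1) * ((n : ℝ) - 2))) *
      (G y v w * G y u z - G y u w * G y v z)

/-- The covariant derivative `(∇ₜ W)(u, v, w, z)` of the Weyl tensor. -/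
def covDerivWeyl (G : Coord n → Coord n →L[ℝ] Coord n →L[ℝ] ℝ) (y t u v w z : Coord n) : ℝ :=
  fderiv ℝ (fun p ↦ weyl G p u v w z) y t
    - weyl G y (christoffel G y t u) v w z - weyl G y u (christoffel G y t v) w z
    - weyl G y u v (christoffel G y t w) z - weyl G y u v w (christoffel G y t z)

/-- The covariant derivative `(∇ₜ B)(u, v)` of a field `B` of bilinear forms. -/
def covDerivForm (G B : Coord n → Coord n →L[ℝ] Coord n →L[ℝ] ℝ) (y t u v : Coord n) : ℝ :=
  fderiv ℝ (fun p ↦ B p u v) y t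
    - B y (christoffel G y t u) v - B y u (christoffel G y t v)

end LocalMetric

/-! ### Pseudo-Riemannian manifolds -/

/-- A field of (not necessarily symmetric) bilinear forms on the tangent spaces of `M`. -/
abbrev BilinField (n : ℕ) (M : Type*) [TopologicalSpace M] [ChartedSpace (Coord n) M] : Type _ :=
  ∀ x : M, TangentSpace (𝓡 n) x →L[ℝ] TangentSpace (𝓡 n) x →L[ℝ] ℝ

namespace BilinField

variable {n : ℕ} {M : Type*} [TopologicalSpace M] [ChartedSpace (Coord n) M]

/-- `C^∞` smoothness on a set, as a section of the bundle of bilinear forms. -/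
def SmoothOn [IsManifold (𝓡 n) ∞ M] (B : BilinField n M) (U : Set M) : Prop :=
  ContMDiffOn (𝓡 n) ((𝓡 n).prod 𝓘(ℝ, Coord n →L[ℝ] Coord n →L[ℝ] ℝ)) ∞
    (fun x ↦ Bundle.TotalSpace.mk' (Coord n →L[ℝ] Coord n →L[ℝ] ℝ)
      (E := fun x : M ↦ TangentSpace (𝓡 n) x →L[ℝ] TangentSpace (𝓡 n) x →L[ℝ] ℝ) x (B x)) U

/-- The expression of `B` in the coordinate chart `φ` around `x₀`: the pullback of `B`
under `φ⁻¹`, a field of bilinear forms on the target of `φ`. -/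
def inChart (B : BilinField n M) (x₀ : M) (y : Coord n) : Coord n →L[ℝ] Coord n →L[ℝ] ℝ :=
  let L : Coord n →L[ℝ] TangentSpace (𝓡 n) ((extChartAt (𝓡 n) x₀).symm y) :=
    mfderiv 𝓘(ℝ, Coord n) (𝓡 n) (extChartAt (𝓡 n) x₀).symm y
  (ContinuousLinearMap.precomp ℝ L).comp ((B ((extChartAt (𝓡 n) x₀).symm y)).comp L)

end BilinField

/-- A smooth pseudo-Riemannian metric (of any signature) on `M`. -/
structure PseudoRiemannianMetric (n : ℕ) (M : Type*) [TopologicalSpace M]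
    [ChartedSpace (Coord n) M] [IsManifold (𝓡 n) ∞ M] where
  /-- The bilinear form on each tangent space. -/
  val : BilinField n M
  symm : ∀ x u v, val x u v = val x v u
  nondegenerate : ∀ x u, (∀ v, val x u v = 0) → u = 0
  smooth : val.SmoothOn Set.univ

namespace PseudoRiemannianMetric

variable {n : ℕ} {M : Type*} [TopologicalSpace M] [ChartedSpace (Coord n) M]
  [IsManifold (𝓡 n) ∞ M]

/-- The Weyl tensor of `g` at `x`, evaluated in the coordinate chart around `x`. -/
def weylAt (g : PseudoRiemannianMetric n M) (x : M) (u v w z : TangentSpace (𝓡 n) x) : ℝ :=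
  let dφ : TangentSpace (𝓡 n) x →L[ℝ] Coord n :=
    mfderiv (𝓡 n) 𝓘(ℝ, Coord n) (extChartAt (𝓡 n) x) x
  LocalMetric.weyl (g.val.inChart x) (extChartAt (𝓡 n) x x) (dφ u) (dφ v) (dφ w) (dφ z)

/-- `∇W = 0`: the components of `∇W` vanish in every coordinate chart. -/
def HasParallelWeyl (g : PseudoRiemannianMetric n M) : Prop :=
  ∀ x₀ : M, ∀ y ∈ (extChartAt (𝓡 n) x₀).target, ∀ t u v w z : Coord n,
    LocalMetric.covDerivWeyl (g.val.inChart x₀) y t u v w z = 0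

/-- `∇B = 0` on `U`: the components of `∇B` vanish on `U` in every coordinate chart. -/
def IsParallelOn (g : PseudoRiemannianMetric n M) (B : BilinField n M) (U : Set M) : Prop :=
  ∀ x₀ : M, ∀ y ∈ (extChartAt (𝓡 n) x₀).target, (extChartAt (𝓡 n) x₀).symm y ∈ U →
    ∀ t u v : Coord n,
      LocalMetric.covDerivForm (g.val.inChart x₀) (B.inChart x₀) y t u v = 0

/-- The Olszak distribution at `x`: all `u` with `g(u, ·) ∧ W(v, v', ·, ·) = 0` for all `v, v'`,
where `(ξ ∧ α)(a, b, c) = ξ(a) α(b, c) + ξ(b) α(c, a) + ξ(c) α(a, b)`. -/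
def olszak (g : PseudoRiemannianMetric n M) (x : M) : Submodule ℝ (TangentSpace (𝓡 n) x) where
  carrier := {u | ∀ v v' a b c : TangentSpace (𝓡 n) x,
    g.val x u a * g.weylAt x v v' b c + g.val x u b * g.weylAt x v v' c a
      + g.val x u c * g.weylAt x v v' a b = 0}
  zero_mem' := by intro v v' a b c; simp
  add_mem' := by
    intro p q hp hq v v' a b c
    have h1 := hp v v' a b c
    have h2 := hq v v' a b c
    simp only [map_add, add_apply]
    linear_combination h1 + h2
  smul_mem' := by
    intro r p hp v v' a b c
    have h1 := hp v v' a b c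
    simp only [map_smul, smul_apply, smul_eq_mul]
    linear_combination r * h1

/-- The Olszak distribution has dimension `d`. -/
def OlszakDimEq (g : PseudoRiemannianMetric n M) (d : ℕ) : Prop :=
  ∀ x : M, Module.finrank ℝ (g.olszak x) = d

/-- The image of `B` at `x`, when `g` is used to identify `B` with a field of endomorphisms
of the tangent spaces: all `w` such that `g(w, ·) = B(u, ·)` for some `u`. -/
def image (g : PseudoRiemannianMetric n M) (B : BilinField n M) (x : M) :
    Submodule ℝ (TangentSpace (𝓡 n) x) where
  carrier := {w | ∃ u, g.val x w = B x u}
  zero_mem' := ⟨0, by simp⟩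
  add_mem' := by
    rintro p q ⟨u, hu⟩ ⟨v, hv⟩
    exact ⟨u + v, by rw [map_add, map_add, hu, hv]⟩
  smul_mem' := by
    rintro r p ⟨u, hu⟩
    exact ⟨r • u, by rw [map_smul, map_smul, hu]⟩

/-- `Ω` represents a parallel `2`-form defined, at each point, only up to a sign. The
values `Ω x` are skew-symmetric, and near every point there is a smooth parallel `2`-form `η` such
that `{Ω x, -Ω x} = {η x, -η x}`. The sign of each single value `Ω x` is an arbitrary choice; in
particular `Ω` itself need not be continuous. -/
def IsParallelTwoFormUpToSign (g : PseudoRiemannianMetric n M) (Ω : BilinField n M) : Prop :=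
  (∀ x u, Ω x u u = 0) ∧
  ∀ x₀ : M, ∃ U : Set M, IsOpen U ∧ x₀ ∈ U ∧ ∃ η : BilinField n M,
    η.SmoothOn U ∧ g.IsParallelOn η U ∧ ∀ x ∈ U, Ω x = η x ∨ Ω x = -η x

/-- `W = ε Ω ⊗ Ω` for the parallel `2`-form `Ω`, defined up to a sign, which has rank `2` at every
point. -/
def IsWeylSquareRoot (g : PseudoRiemannianMetric n M) (ε : ℝ) (Ω : BilinField n M) : Prop :=
  g.IsParallelTwoFormUpToSign Ω ∧
  (∀ x, Module.finrank ℝ (LinearMap.range (Ω x).toLinearMap) = 2) ∧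
  ∀ x u v w z, g.weylAt x u v w z = ε * (Ω x u v * Ω x w z)

end PseudoRiemannianMetric

end

/-! Suppose `d = 2`. At a point `x`, let `p, q` span `𝒟ₓ`. Each 2-form `W(v, v', ·, ·)` is
annihilated by wedging with `g(p, ·)` and `g(q, ·)`, so it is a multiple of `θ = g(p, ·) ∧ g(q, ·)`.
The symmetry `W(u, v, w, z) = W(w, z, u, v)` then gives `W = c θ ⊗ θ` at `x`. Here `c ≠ 0`, since `W
= 0` at `x` would make `𝒟ₓ` the whole tangent space, of dimension `n ≥ 4`. Absorbing `√|c|` into `θ`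
leaves the sign of `c` (`exists_square_root`).

The sign is positive exactly where `W(a, b, a, b) > 0` for some `a, b`, an open condition, and
likewise for negative sign; connectedness makes it constant (`exists_global_sign`). Near a point the
root can be taken as `ε W(a, b, ·, ·) / √(ε W(a, b, a, b))`, which is smooth
(`exists_smooth_sign_change`). It is parallel because `0 = ∇W = ε (∇ω ⊗ ω + ω ⊗ ∇ω)` with `ω ≠ 0`
(`covDerivForm_eq_zero`).

Conversely, a 2-form of rank 2 is decomposable, and the covectors whose wedge with it vanishes are
exactly those in its range. Hence `𝒟ₓ` is the image of `ω` and has dimension 2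
(`wedge_eq_zero_iff_mem_image`). Uniqueness is pointwise algebra (`square_root_unique`).

These arguments compare values of `W` at nearby points in one chart, while `weylAt` uses the chart
centred at each point. The change of charts is an isometry of coordinate metrics, so this rests on
naturality of the Weyl tensor under isometries (`IsIsometryOn.weyl_eq`, `weylAt_eq`). -/

open scoped Manifold ContDiff

noncomputable section

section

set_option maxSynthPendingDepth 3
set_option linter.unusedSectionVars false


/-! ### Levi-Civita connection and curvature of a metric on an open subset of a vector space. -/

namespace LocalMetric

variable {E : Type*} [NormedAddCommGroup E] [NormedSpace ℝ E] [FiniteDimensional ℝ E]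

/-- `G` restricts to a smooth pseudo-Riemannian metric on the open set `S`. -/
structure IsMetricOn (G : E → E →L[ℝ] E →L[ℝ] ℝ) (S : Set (E)) : Prop where
  isOpen : IsOpen S
  contDiffOn : ContDiffOn ℝ ∞ G S
  symm : ∀ y ∈ S, ∀ u v, G y u v = G y v u
  nondegenerate : ∀ y ∈ S, ∀ u, (∀ v, G y u v = 0) → u = 0

/-- A basis of `E` identifies `E →L[ℝ] F` with a finite power of `F`, the components being
evaluations at basis vectors. -/
theorem contDiffAt_clm_iff {F : Type*} [NormedAddCommGroup F] [NormedSpace ℝ F]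
    {f : E → E →L[ℝ] F} {y : E} :
    ContDiffAt ℝ ∞ f y ↔ ∀ u, ContDiffAt ℝ ∞ (fun z ↦ f z u) y := by
  refine ⟨fun h u ↦ h.clm_apply contDiffAt_const, fun h ↦ ?_⟩
  let d := Module.finrank ℝ E
  let e := ((ContinuousLinearEquiv.ofFinrankEq (𝕜 := ℝ) (E := E) (F := Fin d → ℝ)
    (by simp [d])).arrowCongr (1 : F ≃L[ℝ] F)).trans (ContinuousLinearEquiv.piRing (Fin d))
  rw [← Function.id_comp f, ← e.symm_comp_self]
  exact e.symm.contDiff.contDiffAt.comp y (contDiffAt_pi.2 fun i ↦ h _)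

theorem minSmoothness_two_le_infty : minSmoothness ℝ 2 ≤ (∞ : WithTop ℕ∞) := by
  rw [minSmoothness_of_isRCLikeNormedField]
  exact WithTop.coe_le_coe.2 le_top

theorem fderiv_bilin_apply {E' F : Type*} [NormedAddCommGroup E'] [NormedSpace ℝ E']
    [NormedAddCommGroup F] [NormedSpace ℝ F] {B : E → E' →L[ℝ] E' →L[ℝ] F} {a b : E → E'} {y : E}
    (hB : DifferentiableAt ℝ B y) (ha : DifferentiableAt ℝ a y) (hb : DifferentiableAt ℝ b y)
    (t : E) :
    fderiv ℝ (fun z ↦ B z (a z) (b z)) y t = fderiv ℝ B y t (a y) (b y)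
      + B y (fderiv ℝ a y t) (b y) + B y (a y) (fderiv ℝ b y t) := by
  rw [fderiv_clm_apply (by fun_prop) hb, fderiv_clm_apply hB ha]
  simp
  abel

theorem fderiv_bilin_apply_const {F : Type*} [NormedAddCommGroup F] [NormedSpace ℝ F]
    {B : E → E →L[ℝ] E →L[ℝ] F} {y : E} (hB : DifferentiableAt ℝ B y) (u v t : E) :
    fderiv ℝ (fun z ↦ B z u v) y t = fderiv ℝ B y t u v := by
  simp [fderiv_bilin_apply hB (differentiableAt_const u) (differentiableAt_const v)]

theorem fderiv_clm_apply_const {F : Type*} [NormedAddCommGroup F] [NormedSpace ℝ F]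
    {A : E → E →L[ℝ] F} {y : E} (hA : DifferentiableAt ℝ A y) (u t : E) :
    fderiv ℝ (fun z ↦ A z u) y t = fderiv ℝ A y t u := by
  simp [fderiv_clm_apply hA (differentiableAt_const u)]

namespace IsMetricOn

variable {G : E → E →L[ℝ] E →L[ℝ] ℝ} {S : Set (E)}

theorem contDiffAt (h : IsMetricOn G S) {y : E} (hy : y ∈ S) : ContDiffAt ℝ ∞ G y :=
  h.contDiffOn.contDiffAt (h.isOpen.mem_nhds hy)

theorem exists_equiv (h : IsMetricOn G S) {y : E} (hy : y ∈ S) :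
    ∃ e : E ≃L[ℝ] (E →L[ℝ] ℝ), (e : E →L[ℝ] (E →L[ℝ] ℝ)) = G y := by
  have hinj : Function.Injective (G y).toLinearMap := by
    rw [injective_iff_map_eq_zero]
    intro u hu
    exact h.nondegenerate y hy u fun v ↦ by
      have := congrArg (fun f : E →L[ℝ] ℝ ↦ f v) hu
      simpa using this
  have hd : Module.finrank ℝ (E) = Module.finrank ℝ (E →L[ℝ] ℝ) := by
    rw [← (LinearMap.toContinuousLinearMap (𝕜 := ℝ) (E := E) (F' := ℝ)).finrank_eq]
    exact (Subspace.dual_finrank_eq).symm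
  refine ⟨(LinearEquiv.ofInjectiveOfFinrankEq (G y).toLinearMap hinj hd).toContinuousLinearEquiv, ?_⟩
  ext u v
  rfl

theorem apply_inverse (h : IsMetricOn G S) {y : E} (hy : y ∈ S) (ξ : E →L[ℝ] ℝ) :
    G y ((G y).inverse ξ) = ξ := by
  obtain ⟨e, he⟩ := h.exists_equiv hy
  rw [← he, ContinuousLinearMap.inverse_equiv]
  exact e.apply_symm_apply ξ

theorem eq_of_forall (h : IsMetricOn G S) {y : E} (hy : y ∈ S) {a b : E}
    (hab : ∀ v, G y a v = G y b v) : a = b :=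
  sub_eq_zero.1 (h.nondegenerate y hy _ fun v ↦ by simp [hab v])

theorem contDiffAt_inverse (h : IsMetricOn G S) {y : E} (hy : y ∈ S)
    {ξ : E → E →L[ℝ] ℝ} (hξ : ContDiffAt ℝ ∞ ξ y) :
    ContDiffAt ℝ ∞ (fun z ↦ (G z).inverse (ξ z)) y := by
  obtain ⟨e, he⟩ := h.exists_equiv hy
  have h1 : ContDiffAt ℝ ∞ (ContinuousLinearMap.inverse :
      (E →L[ℝ] (E →L[ℝ] ℝ)) → _) (G y) := by
    rw [← he]; exact contDiffAt_map_inverse e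
  exact (h1.comp y (h.contDiffAt hy)).clm_apply hξ

end IsMetricOn

/-- The Christoffel symbols of the Levi-Civita connection, as a continuous bilinear map. -/
def leviCivita (G : E → E →L[ℝ] E →L[ℝ] ℝ) (y : E) : E →L[ℝ] E →L[ℝ] E :=
  (LinearMap.mk₂ ℝ (fun u v ↦ (G y).inverse ((1 / 2 : ℝ) •
      (fderiv ℝ G y u v + fderiv ℝ G y v u - ((fderiv ℝ G y).flip u).flip v)))
    (fun u u' v ↦ by simp only [← map_add]; congr 1; ext; simp; ring)
    (fun c u v ↦ by simp only [← map_smul]; congr 1; ext; simp; ring)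
    (fun u u' v ↦ by simp only [← map_add]; congr 1; ext; simp; ring)
    (fun c u v ↦ by simp only [← map_smul]; congr 1; ext; simp; ring)
    ).toContinuousBilinearMap

theorem leviCivita_apply (G : E → E →L[ℝ] E →L[ℝ] ℝ) (y u v : E) :
    leviCivita G y u v = (G y).inverse ((1 / 2 : ℝ) •
      (fderiv ℝ G y u v + fderiv ℝ G y v u - ((fderiv ℝ G y).flip u).flip v)) := rfl

/-- The curvature of the connection with Christoffel symbols `Γ`. -/
def connCurvature (Γ : E → E →L[ℝ] E →L[ℝ] E) (y u v w : E) : E :=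
  fderiv ℝ Γ y u v w - fderiv ℝ Γ y v u w + Γ y u (Γ y v w) - Γ y v (Γ y u w)

theorem connCurvature_skew (Γ : E → E →L[ℝ] E →L[ℝ] E) (y u v w : E) :
    connCurvature Γ y u v w = -connCurvature Γ y v u w := by
  simp only [connCurvature]; abel

namespace IsMetricOn

variable {G : E → E →L[ℝ] E →L[ℝ] ℝ} {S : Set (E)}

theorem fderiv_symm (h : IsMetricOn G S) {y : E} (hy : y ∈ S) (t u v : E) :
    fderiv ℝ G y t u v = fderiv ℝ G y t v u := by
  have hd := (h.contDiffAt hy).differentiableAt (by simp)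
  rw [← fderiv_bilin_apply_const hd, ← fderiv_bilin_apply_const hd]
  congr 1
  apply Filter.EventuallyEq.fderiv_eq
  filter_upwards [h.isOpen.mem_nhds hy] with z hz
  exact h.symm z hz u v

theorem koszul (h : IsMetricOn G S) {y : E} (hy : y ∈ S) (u v w : E) :
    2 * G y (leviCivita G y u v) w =
      fderiv ℝ G y u v w + fderiv ℝ G y v u w - fderiv ℝ G y w u v := by
  rw [leviCivita_apply, h.apply_inverse hy]
  simp

theorem leviCivita_symm (h : IsMetricOn G S) {y : E} (hy : y ∈ S) (u v : E) :
    leviCivita G y u v = leviCivita G y v u := by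
  refine h.eq_of_forall hy fun w ↦ ?_
  have h1 := h.koszul hy u v w
  have h2 := h.koszul hy v u w
  have h3 := h.fderiv_symm hy w u v
  linarith

/-- Compatibility `∇G = 0`: in the sum of the Koszul formulas for `(t, u, v)` and `(t, v, u)` all
other derivatives cancel. -/
theorem fderiv_metric (h : IsMetricOn G S) {y : E} (hy : y ∈ S) (t u v : E) :
    fderiv ℝ G y t u v = G y (leviCivita G y t u) v + G y u (leviCivita G y t v) := by
  have h1 := h.koszul hy t u v
  have h2 := h.koszul hy t v u
  have h3 := h.fderiv_symm hy t u v
  have h4 := h.fderiv_symm hy u t v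
  have h5 := h.fderiv_symm hy v t u
  have h6 := h.symm y hy u (leviCivita G y t v)
  linarith

theorem contDiffAt_fderiv (h : IsMetricOn G S) {y : E} (hy : y ∈ S) :
    ContDiffAt ℝ ∞ (fderiv ℝ G) y :=
  (h.contDiffAt hy).fderiv_right (by simp)

theorem contDiffAt_leviCivita (h : IsMetricOn G S) {y : E} (hy : y ∈ S) :
    ContDiffAt ℝ ∞ (leviCivita G) y := by
  have hd := h.contDiffAt_fderiv hy
  refine contDiffAt_clm_iff.2 fun u ↦ contDiffAt_clm_iff.2 fun v ↦ h.contDiffAt_inverse hy ?_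
  refine contDiffAt_clm_iff.2 fun w ↦ ?_
  simp only [smul_apply, add_apply,
    sub_apply, ContinuousLinearMap.flip_apply]
  fun_prop

theorem contDiffAt_fderiv_leviCivita (h : IsMetricOn G S) {y : E} (hy : y ∈ S) :
    ContDiffAt ℝ ∞ (fderiv ℝ (leviCivita G)) y :=
  (h.contDiffAt_leviCivita hy).fderiv_right (by simp)

theorem differentiableAt_leviCivita (h : IsMetricOn G S) {y : E} (hy : y ∈ S) :
    DifferentiableAt ℝ (leviCivita G) y :=
  (h.contDiffAt_leviCivita hy).differentiableAt (by simp)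

theorem fderiv_leviCivita_symm (h : IsMetricOn G S) {y : E} (hy : y ∈ S)
    (t u v : E) :
    fderiv ℝ (leviCivita G) y t u v = fderiv ℝ (leviCivita G) y t v u := by
  have hd := h.differentiableAt_leviCivita hy
  rw [← fderiv_bilin_apply_const hd, ← fderiv_bilin_apply_const hd]
  congr 1
  apply Filter.EventuallyEq.fderiv_eq
  filter_upwards [h.isOpen.mem_nhds hy] with z hz
  exact h.leviCivita_symm hz u v

theorem bianchi (h : IsMetricOn G S) {y : E} (hy : y ∈ S) (u v w : E) :
    connCurvature (leviCivita G) y u v w + connCurvature (leviCivita G) y v w u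
      + connCurvature (leviCivita G) y w u v = 0 := by
  simp only [connCurvature]
  have hs : ∀ a b, leviCivita G y a b = leviCivita G y b a := h.leviCivita_symm hy
  rw [h.fderiv_leviCivita_symm hy u v w, h.fderiv_leviCivita_symm hy v w u,
    h.fderiv_leviCivita_symm hy w u v, hs v w, hs u w, hs u v]
  abel

/-- Differentiating `∇G = 0` once more expresses the second derivative of `G` through `Γ` and its
derivative; antisymmetrizing in the two directions of differentiation kills the left side and leaves
the curvature. -/
theorem connCurvature_metric_skew (h : IsMetricOn G S) {y : E} (hy : y ∈ S)
    (u v w z : E) :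
    G y (connCurvature (leviCivita G) y u v w) z = -G y (connCurvature (leviCivita G) y u v z) w := by
  have hG := (h.contDiffAt hy).differentiableAt (by simp)
  have hΓ := h.differentiableAt_leviCivita hy
  have hdG := (h.contDiffAt_fderiv hy).differentiableAt (by simp)
  have key : ∀ t a, fderiv ℝ (fderiv ℝ G) y t a w z
      = fderiv ℝ G y t (leviCivita G y a w) z + G y (fderiv ℝ (leviCivita G) y t a w) z
        + (fderiv ℝ G y t w (leviCivita G y a z)
          + G y w (fderiv ℝ (leviCivita G) y t a z)) := by
    intro t a
    have e1 : (fun p ↦ fderiv ℝ G p a w z) =ᶠ[nhds y] fun p ↦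
        G p (leviCivita G p a w) z + G p w (leviCivita G p a z) := by
      filter_upwards [h.isOpen.mem_nhds hy] with p hp
      exact h.fderiv_metric hp a w z
    have e2 := congrArg (fun f : E →L[ℝ] ℝ ↦ f t) e1.fderiv_eq
    rw [fderiv_bilin_apply_const (by fun_prop), fderiv_clm_apply_const hdG,
      fderiv_fun_add (by fun_prop) (by fun_prop), add_apply,
      fderiv_bilin_apply hG (by fun_prop) (by fun_prop),
      fderiv_bilin_apply hG (by fun_prop) (by fun_prop), fderiv_bilin_apply_const hΓ,
      fderiv_bilin_apply_const hΓ] at e2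
    simp only [fderiv_fun_const, Pi.zero_apply, zero_apply, map_zero, add_zero] at e2
    linarith
  have hsymm := (h.contDiffAt hy).isSymmSndFDerivAt
    (minSmoothness_two_le_infty) u v
  have h1 := key u v
  have h2 := key v u
  rw [hsymm] at h1
  simp only [h.fderiv_metric hy] at h1 h2
  have hs := h.symm y hy
  simp only [connCurvature, map_add, map_sub, add_apply,
    sub_apply]
  rw [hs w, hs w] at h1 h2
  linarith [hs (leviCivita G y v w) (leviCivita G y u z),
    hs (leviCivita G y u w) (leviCivita G y v z)]

/-- The classical octahedron argument: combine the four Bianchi identities having each of `u, v, w,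
z` in turn in the last slot, using skewness in both pairs. -/
theorem connCurvature_pair_symm (h : IsMetricOn G S) {y : E} (hy : y ∈ S)
    (u v w z : E) :
    G y (connCurvature (leviCivita G) y u v w) z = G y (connCurvature (leviCivita G) y w z u) v := by
  have B : ∀ a b c d, G y (connCurvature (leviCivita G) y a b c) d
      + G y (connCurvature (leviCivita G) y b c a) d
      + G y (connCurvature (leviCivita G) y c a b) d = 0 := by
    intro a b c d
    have := congrArg (fun x ↦ G y x d) (h.bianchi hy a b c)
    simpa using this
  have K := h.connCurvature_metric_skew hy
  have K' : ∀ a b c d, G y (connCurvature (leviCivita G) y a b c) d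
      = -G y (connCurvature (leviCivita G) y b a c) d := by
    intro a b c d
    rw [connCurvature_skew]; simp
  linarith [B u v w z, B v w z u, B w z u v, B z u v w, K u v w z, K v w z u, K w z u v, K z u v w,
    K' w u v z, K v w u z, K w u v z, K u w v z, K' v w z u, K w z v u, K z v w u, K' z v w u,
    K z u w v, K' u v z w, K v z w u, K' z w u v, K u w z v, K' u w z v, K v z u w, K' v z u w]

end IsMetricOn

/-! ### Naturality of the connection and curvature under isometric maps. -/

/-- `τ` is a smooth isometric map from the metric `G` on `S` to the metric `G'` on `S'`. -/
structure IsIsometryOn (G G' : E → E →L[ℝ] E →L[ℝ] ℝ) (S S' : Set E) (τ : E → E) : Prop where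
  metric : IsMetricOn G S
  metric' : IsMetricOn G' S'
  contDiffOn : ContDiffOn ℝ ∞ τ S
  mapsTo : Set.MapsTo τ S S'
  pullback : ∀ y ∈ S, ∀ u v, G y u v = G' (τ y) (fderiv ℝ τ y u) (fderiv ℝ τ y v)

namespace IsIsometryOn

variable {G G' : E → E →L[ℝ] E →L[ℝ] ℝ} {S S' : Set E} {τ : E → E}

theorem contDiffAt (h : IsIsometryOn G G' S S' τ) {y : E} (hy : y ∈ S) : ContDiffAt ℝ ∞ τ y :=
  h.contDiffOn.contDiffAt (h.metric.isOpen.mem_nhds hy)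

theorem exists_equiv (h : IsIsometryOn G G' S S' τ) {y : E} (hy : y ∈ S) :
    ∃ e : E ≃ₗ[ℝ] E, ∀ u, e u = fderiv ℝ τ y u := by
  refine ⟨LinearEquiv.ofInjectiveEndo (fderiv ℝ τ y).toLinearMap ?_, fun u ↦ rfl⟩
  rw [injective_iff_map_eq_zero]
  intro u hu
  refine h.metric.nondegenerate y hy u fun v ↦ ?_
  rw [h.pullback y hy, show fderiv ℝ τ y u = 0 from hu]
  simp

theorem contDiffAt_fderiv (h : IsIsometryOn G G' S S' τ) {y : E} (hy : y ∈ S) :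
    ContDiffAt ℝ ∞ (fderiv ℝ τ) y :=
  (h.contDiffAt hy).fderiv_right (by simp)

theorem fderiv_metric (h : IsIsometryOn G G' S S' τ) {y : E} (hy : y ∈ S) (t u v : E) :
    fderiv ℝ G y t u v =
      fderiv ℝ G' (τ y) (fderiv ℝ τ y t) (fderiv ℝ τ y u) (fderiv ℝ τ y v)
        + G' (τ y) (fderiv ℝ (fderiv ℝ τ) y t u) (fderiv ℝ τ y v)
        + G' (τ y) (fderiv ℝ τ y u) (fderiv ℝ (fderiv ℝ τ) y t v) := by
  have hG := (h.metric.contDiffAt hy).differentiableAt (by simp)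
  have hG' := (h.metric'.contDiffAt (h.mapsTo hy)).differentiableAt (by simp)
  have hτ := (h.contDiffAt hy).differentiableAt (by simp)
  have hdτ := (h.contDiffAt_fderiv hy).differentiableAt (by simp)
  have hc : DifferentiableAt ℝ (fun z ↦ G' (τ z)) y := hG'.comp y hτ
  have e1 : (fun z ↦ G z u v) =ᶠ[nhds y] fun z ↦
      G' (τ z) (fderiv ℝ τ z u) (fderiv ℝ τ z v) := by
    filter_upwards [h.metric.isOpen.mem_nhds hy] with z hz
    exact h.pullback z hz u v
  have e2 : fderiv ℝ (fun z ↦ G' (τ z)) y t = fderiv ℝ G' (τ y) (fderiv ℝ τ y t) :=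
    congrArg (fun f : E →L[ℝ] _ ↦ f t) (fderiv_comp y hG' hτ)
  rw [← fderiv_bilin_apply_const hG, e1.fderiv_eq,
    fderiv_bilin_apply hc (by fun_prop) (by fun_prop), e2, fderiv_clm_apply_const hdτ,
    fderiv_clm_apply_const hdτ]

/-- Substituting the derivative of the pullback relation into the Koszul formula, symmetry of `D²τ`
cancels every second-order term except `2 G'(D²τ(u, v), Dτ w)`. -/
theorem leviCivita_eq (h : IsIsometryOn G G' S S' τ) {y : E} (hy : y ∈ S) (u v : E) :
    fderiv ℝ τ y (leviCivita G y u v) =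
      leviCivita G' (τ y) (fderiv ℝ τ y u) (fderiv ℝ τ y v) + fderiv ℝ (fderiv ℝ τ) y u v := by
  obtain ⟨e, he⟩ := h.exists_equiv hy
  refine h.metric'.eq_of_forall (h.mapsTo hy) fun w' ↦ ?_
  obtain ⟨w, rfl⟩ := e.surjective w'
  have k1 := h.metric.koszul hy u v w
  have k2 := h.metric'.koszul (h.mapsTo hy) (fderiv ℝ τ y u) (fderiv ℝ τ y v) (fderiv ℝ τ y w)
  simp only [h.fderiv_metric hy] at k1
  rw [h.pullback y hy] at k1
  have hs := (h.contDiffAt hy).isSymmSndFDerivAt minSmoothness_two_le_infty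
  rw [he, map_add, add_apply]
  have hG := h.metric'.symm (τ y) (h.mapsTo hy)
  rw [hs v u, hs w u, hs w v, hG (fderiv ℝ τ y v), hG (fderiv ℝ τ y u)] at k1
  linarith

/-- Differentiate the transformation law of `Γ` and antisymmetrize: the non-tensorial terms drop out
because `D²τ` is symmetric and `D³τ` is symmetric in its first two arguments. -/
theorem connCurvature_eq (h : IsIsometryOn G G' S S' τ) {y : E} (hy : y ∈ S) (u v w : E) :
    fderiv ℝ τ y (connCurvature (leviCivita G) y u v w) =
      connCurvature (leviCivita G') (τ y) (fderiv ℝ τ y u) (fderiv ℝ τ y v) (fderiv ℝ τ y w) := by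
  have hΓ := h.metric.differentiableAt_leviCivita hy
  have hΓ' := h.metric'.differentiableAt_leviCivita (h.mapsTo hy)
  have hτ := (h.contDiffAt hy).differentiableAt (by simp)
  have hdτ' := h.contDiffAt_fderiv hy
  have hdτ := hdτ'.differentiableAt (by simp)
  have hddτ : DifferentiableAt ℝ (fderiv ℝ (fderiv ℝ τ)) y :=
    ((h.contDiffAt_fderiv hy).fderiv_right (m := ∞) (by simp)).differentiableAt (by simp)
  have hc : DifferentiableAt ℝ (fun z ↦ leviCivita G' (τ z)) y := hΓ'.comp y hτ
  have key : ∀ t a, fderiv ℝ (fderiv ℝ τ) y t (leviCivita G y a w)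
        + fderiv ℝ τ y (fderiv ℝ (leviCivita G) y t a w)
      = fderiv ℝ (leviCivita G') (τ y) (fderiv ℝ τ y t) (fderiv ℝ τ y a) (fderiv ℝ τ y w)
        + leviCivita G' (τ y) (fderiv ℝ (fderiv ℝ τ) y t a) (fderiv ℝ τ y w)
        + leviCivita G' (τ y) (fderiv ℝ τ y a) (fderiv ℝ (fderiv ℝ τ) y t w)
        + fderiv ℝ (fderiv ℝ (fderiv ℝ τ)) y t a w := by
    intro t a
    have e1 : (fun z ↦ fderiv ℝ τ z (leviCivita G z a w)) =ᶠ[nhds y] fun z ↦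
        leviCivita G' (τ z) (fderiv ℝ τ z a) (fderiv ℝ τ z w) + fderiv ℝ (fderiv ℝ τ) z a w := by
      filter_upwards [h.metric.isOpen.mem_nhds hy] with z hz
      exact h.leviCivita_eq hz a w
    have e2 : fderiv ℝ (fun z ↦ leviCivita G' (τ z)) y t
        = fderiv ℝ (leviCivita G') (τ y) (fderiv ℝ τ y t) :=
      congrArg (fun f : E →L[ℝ] _ ↦ f t) (fderiv_comp y hΓ' hτ)
    have e3 := congrArg (fun f : E →L[ℝ] E ↦ f t) e1.fderiv_eq
    rw [fderiv_clm_apply (by fun_prop) (by fun_prop), fderiv_fun_add (by fun_prop) (by fun_prop),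
      add_apply, add_apply, fderiv_bilin_apply hc (by fun_prop) (by fun_prop), e2,
      fderiv_clm_apply_const hdτ, fderiv_clm_apply_const hdτ, fderiv_bilin_apply_const hddτ] at e3
    simp only [ContinuousLinearMap.comp_apply, ContinuousLinearMap.flip_apply] at e3
    rw [fderiv_bilin_apply_const hΓ] at e3
    rw [← e3, add_comm]
  have hs := hdτ'.isSymmSndFDerivAt minSmoothness_two_le_infty u v
  have k1 := eq_sub_of_add_eq' (key u v)
  have k2 := eq_sub_of_add_eq' (key v u)
  have hs2 := (h.contDiffAt hy).isSymmSndFDerivAt minSmoothness_two_le_infty u v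
  simp only [connCurvature, map_add, map_sub, h.leviCivita_eq hy, k1, k2, hs, hs2]
  abel

end IsIsometryOn

end LocalMetric


/-! ### Ricci, scalar and Weyl curvature as basis-free traces. -/

namespace LocalMetric

section

variable {E : Type*} [NormedAddCommGroup E] [NormedSpace ℝ E] [FiniteDimensional ℝ E]

/-- The curvature operator `u ↦ R(u, v) w`, linear in each of its arguments. -/
def curvatureEnd (Γ : E → E →L[ℝ] E →L[ℝ] E) (y : E) : E →ₗ[ℝ] E →ₗ[ℝ] E →ₗ[ℝ] E :=
  LinearMap.mk₂ ℝ
    (fun v w ↦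
      { toFun := fun u ↦ connCurvature Γ y u v w
        map_add' := fun a b ↦ by simp [connCurvature]; abel
        map_smul' := fun c a ↦ by simp [connCurvature, smul_sub, smul_add] })
    (fun a b w ↦ by ext u; simp [connCurvature]; abel)
    (fun c a w ↦ by ext u; simp [connCurvature, smul_sub, smul_add])
    (fun v a b ↦ by ext u; simp [connCurvature]; abel)
    (fun c v a ↦ by ext u; simp [connCurvature, smul_sub, smul_add])

theorem curvatureEnd_apply (Γ : E → E →L[ℝ] E →L[ℝ] E) (y u v w : E) :
    curvatureEnd Γ y v w u = connCurvature Γ y u v w := rfl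

/-- The Ricci tensor of a connection, as a bilinear form. -/
def ricciForm (Γ : E → E →L[ℝ] E →L[ℝ] E) (y : E) : E →L[ℝ] E →L[ℝ] ℝ :=
  ((curvatureEnd Γ y).compr₂ (LinearMap.trace ℝ E)).toContinuousBilinearMap

theorem ricciForm_apply (Γ : E → E →L[ℝ] E →L[ℝ] E) (y v w : E) :
    ricciForm Γ y v w = LinearMap.trace ℝ E (curvatureEnd Γ y v w) := rfl

namespace IsMetricOn

variable {G : E → E →L[ℝ] E →L[ℝ] ℝ} {S : Set E}

/-- By pair symmetry, lowering an index with `G` turns the transpose of `u ↦ R(u, v) w` into `z ↦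
R(z, w) v`; the two endomorphisms therefore have the same trace. -/
theorem ricciForm_symm (h : IsMetricOn G S) {y : E} (hy : y ∈ S) (v w : E) :
    ricciForm (leviCivita G) y v w = ricciForm (leviCivita G) y w v := by
  obtain ⟨e, he⟩ := h.exists_equiv hy
  let e' : E ≃ₗ[ℝ] Module.Dual ℝ E :=
    e.toLinearEquiv.trans (LinearMap.toContinuousLinearMap (𝕜 := ℝ) (E := E) (F' := ℝ)).symm
  have he' : ∀ a b, e' a b = G y a b := by
    intro a b
    rw [← he]; rfl
  rw [ricciForm_apply, ricciForm_apply, ← LinearMap.trace_transpose' (curvatureEnd _ y v w),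
    ← LinearMap.trace_conj' (curvatureEnd _ y w v) e']
  congr 1
  ext f u
  obtain ⟨z, rfl⟩ := e'.surjective f
  simp only [Module.Dual.transpose_apply, LinearEquiv.conj_apply_apply,
    LinearEquiv.symm_apply_apply, LinearMap.comp_apply, he', curvatureEnd_apply]
  rw [h.symm y hy z, h.connCurvature_pair_symm hy u v w z, connCurvature_skew,
    map_neg, neg_apply, h.connCurvature_metric_skew hy z w v u]

end IsMetricOn

/-- The scalar curvature of a metric. -/
def scalarTrace (G : E → E →L[ℝ] E →L[ℝ] ℝ) (y : E) : ℝ :=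
  LinearMap.trace ℝ E ((G y).inverse ∘L ricciForm (leviCivita G) y).toLinearMap

namespace IsIsometryOn

variable {G G' : E → E →L[ℝ] E →L[ℝ] ℝ} {S S' : Set E} {τ : E → E}

theorem ricciForm_eq (h : IsIsometryOn G G' S S' τ) {y : E} (hy : y ∈ S) (v w : E) :
    ricciForm (leviCivita G) y v w =
      ricciForm (leviCivita G') (τ y) (fderiv ℝ τ y v) (fderiv ℝ τ y w) := by
  obtain ⟨e, he⟩ := h.exists_equiv hy
  rw [ricciForm_apply, ricciForm_apply, ← LinearMap.trace_conj' (curvatureEnd _ y v w) e]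
  congr 1
  ext u'
  obtain ⟨u, rfl⟩ := e.surjective u'
  rw [LinearEquiv.conj_apply_apply, e.symm_apply_apply, curvatureEnd_apply, curvatureEnd_apply,
    he, he, h.connCurvature_eq hy]

/-- `Dτ` conjugates the two endomorphisms `G⁻¹ ∘ ρ`, as is seen by pairing with an arbitrary vector.
-/
theorem scalarTrace_eq (h : IsIsometryOn G G' S S' τ) {y : E} (hy : y ∈ S) :
    scalarTrace G y = scalarTrace G' (τ y) := by
  obtain ⟨e, he⟩ := h.exists_equiv hy
  rw [scalarTrace, scalarTrace, ← LinearMap.trace_conj' _ e]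
  congr 1
  ext u'
  obtain ⟨u, rfl⟩ := e.surjective u'
  rw [LinearEquiv.conj_apply_apply, e.symm_apply_apply]
  refine h.metric'.eq_of_forall (h.mapsTo hy) fun w' ↦ ?_
  obtain ⟨w, rfl⟩ := e.surjective w'
  simp only [ContinuousLinearMap.coe_coe, ContinuousLinearMap.comp_apply,
    h.metric'.apply_inverse (h.mapsTo hy)]
  rw [he, he, he, ← h.pullback y hy, h.metric.apply_inverse hy, h.ricciForm_eq hy]

end IsIsometryOn

end

variable {n : ℕ}

theorem sum_apply_basisVec (f : Coord n →ₗ[ℝ] Coord n) :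
    ∑ i, f (basisVec i) i = LinearMap.trace ℝ (Coord n) f := by
  rw [LinearMap.trace_eq_matrix_trace ℝ (EuclideanSpace.basisFun (Fin n) ℝ).toBasis]
  simp [Matrix.trace, LinearMap.toMatrix_apply, basisVec]

theorem sum_smul_basisVec (u : Coord n) : ∑ i, u i • basisVec i = u := by
  have := (EuclideanSpace.basisFun (Fin n) ℝ).sum_repr u
  simpa [basisVec] using this

theorem christoffel_eq (G : Coord n → Coord n →L[ℝ] Coord n →L[ℝ] ℝ) (y u v : Coord n) :
    christoffel G y u v = leviCivita G y u v := rfl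

namespace IsMetricOn

variable {G : Coord n → Coord n →L[ℝ] Coord n →L[ℝ] ℝ} {S : Set (Coord n)}

theorem curvature_eq (h : IsMetricOn G S) {y : Coord n} (hy : y ∈ S) (u v w : Coord n) :
    curvature G y u v w = connCurvature (leviCivita G) y u v w := by
  have hd := h.differentiableAt_leviCivita hy
  simp only [curvature, christoffel_eq, fderiv_bilin_apply_const hd, connCurvature]

theorem ricci_eq (h : IsMetricOn G S) {y : Coord n} (hy : y ∈ S) (v w : Coord n) :
    ricci G y v w = ricciForm (leviCivita G) y v w := by
  rw [ricciForm_apply, ← sum_apply_basisVec]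
  simp only [ricci, h.curvature_eq hy, curvatureEnd_apply]

theorem scalar_eq (h : IsMetricOn G S) {y : Coord n} (hy : y ∈ S) :
    scalar G y = scalarTrace G y := by
  rw [scalarTrace, ← sum_apply_basisVec, scalar, Finset.sum_comm]
  refine Finset.sum_congr rfl fun j _ ↦ ?_
  simp only [h.ricci_eq hy]
  -- The sum over `i` merely expands the vector `sharp (dxʲ)` in the coordinate basis.
  have e1 : ∑ i, sharp G y (EuclideanSpace.proj j) i *
      ricciForm (leviCivita G) y (basisVec i) (basisVec j) =
      ricciForm (leviCivita G) y (sharp G y (EuclideanSpace.proj j)) (basisVec j) := by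
    conv_rhs => rw [← sum_smul_basisVec (sharp G y (EuclideanSpace.proj j))]
    simp
  rw [e1, h.ricciForm_symm hy,
    ← h.apply_inverse hy (ricciForm (leviCivita G) y (basisVec j)), h.symm y hy, sharp,
    h.apply_inverse hy]
  rfl

theorem weyl_skew (h : IsMetricOn G S) {y : Coord n} (hy : y ∈ S) (u v w z : Coord n) :
    weyl G y u v w z = -weyl G y u v z w := by
  have := h.connCurvature_metric_skew hy u v w z
  simp only [weyl, h.curvature_eq hy]
  rw [this]
  ring

theorem weyl_pair_symm (h : IsMetricOn G S) {y : Coord n} (hy : y ∈ S) (u v w z : Coord n) :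
    weyl G y u v w z = weyl G y w z u v := by
  have hR := h.connCurvature_pair_symm hy u v w z
  have hr := h.ricciForm_symm hy
  have hs := h.symm y hy
  simp only [weyl, h.curvature_eq hy, h.ricci_eq hy]
  rw [hR, hs u z, hs v w, hs u w, hs v z, hr v w, hr u z, hr u w, hr v z]
  ring

theorem contDiffAt_curvature (h : IsMetricOn G S) {y : Coord n} (hy : y ∈ S) (u v w : Coord n) :
    ContDiffAt ℝ ∞ (fun z ↦ curvature G z u v w) y := by
  have h1 := h.contDiffAt_leviCivita hy
  have h2 := h.contDiffAt_fderiv_leviCivita hy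
  have : ContDiffAt ℝ ∞ (fun z ↦ connCurvature (leviCivita G) z u v w) y := by
    unfold connCurvature
    fun_prop
  refine this.congr_of_eventuallyEq ?_
  filter_upwards [h.isOpen.mem_nhds hy] with z hz
  exact h.curvature_eq hz u v w

theorem contDiffAt_ricci (h : IsMetricOn G S) {y : Coord n} (hy : y ∈ S) (v w : Coord n) :
    ContDiffAt ℝ ∞ (fun z ↦ ricci G z v w) y := by
  unfold ricci
  refine ContDiffAt.sum fun i _ ↦ ?_
  exact (contDiffAt_piLp 2).1 (h.contDiffAt_curvature hy _ _ _) i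

theorem contDiffAt_scalar (h : IsMetricOn G S) {y : Coord n} (hy : y ∈ S) :
    ContDiffAt ℝ ∞ (fun z ↦ scalar G z) y := by
  unfold scalar
  refine ContDiffAt.sum fun i _ ↦ ContDiffAt.sum fun j _ ↦ ContDiffAt.mul ?_
    (h.contDiffAt_ricci hy _ _)
  exact (contDiffAt_piLp 2).1 (h.contDiffAt_inverse hy contDiffAt_const) i

theorem contDiffAt_weyl (h : IsMetricOn G S) {y : Coord n} (hy : y ∈ S) (u v w z : Coord n) :
    ContDiffAt ℝ ∞ (fun p ↦ weyl G p u v w z) y := by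
  have h0 := h.contDiffAt hy
  have h1 := h.contDiffAt_curvature hy u v w
  have h2 := h.contDiffAt_ricci hy
  have h3 := h.contDiffAt_scalar hy
  unfold weyl
  fun_prop

end IsMetricOn

/-- Every ingredient of `weyl` is natural; writing the Ricci and scalar curvatures as traces is what
makes this visible for the coordinate sums. -/
theorem IsIsometryOn.weyl_eq {G G' : Coord n → Coord n →L[ℝ] Coord n →L[ℝ] ℝ}
    {S S' : Set (Coord n)} {τ : Coord n → Coord n} (h : IsIsometryOn G G' S S' τ)
    {y : Coord n} (hy : y ∈ S) (u v w z : Coord n) :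
    weyl G y u v w z =
      weyl G' (τ y) (fderiv ℝ τ y u) (fderiv ℝ τ y v) (fderiv ℝ τ y w) (fderiv ℝ τ y z) := by
  simp only [weyl, h.metric.curvature_eq hy, h.metric'.curvature_eq (h.mapsTo hy),
    h.metric.ricci_eq hy, h.metric'.ricci_eq (h.mapsTo hy), h.metric.scalar_eq hy,
    h.metric'.scalar_eq (h.mapsTo hy), h.pullback y hy, h.connCurvature_eq hy, h.ricciForm_eq hy,
    h.scalarTrace_eq hy]

/-- If `∇W = 0` and `W = ε B ⊗ B` near a point at which `B ≠ 0`, then `∇B = 0` there. -/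
theorem covDerivForm_eq_zero {G B : Coord n → Coord n →L[ℝ] Coord n →L[ℝ] ℝ} {y : Coord n} {ε : ℝ}
    (hε : ε ≠ 0) (hB : DifferentiableAt ℝ B y)
    (hW : ∀ᶠ p in nhds y, ∀ u v w z, weyl G p u v w z = ε * (B p u v * B p w z))
    (hpar : ∀ t u v w z, covDerivWeyl G y t u v w z = 0) (hne : B y ≠ 0) (t u v : Coord n) :
    covDerivForm G B y t u v = 0 := by
  -- The Leibniz rule for `∇(B ⊗ B)`, with the nonzero factor `ε` removed.
  have key : ∀ u v w z, covDerivForm G B y t u v * B y w z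
      + B y u v * covDerivForm G B y t w z = 0 := by
    intro u v w z
    have h1 := hpar t u v w z
    have e1 : (fun p ↦ weyl G p u v w z) =ᶠ[nhds y] fun p ↦ ε * (B p u v * B p w z) := by
      filter_upwards [hW] with p hp
      exact hp u v w z
    have hB' : ∀ a b, DifferentiableAt ℝ (fun p ↦ B p a b) y := fun a b ↦ by fun_prop
    rw [covDerivWeyl, e1.fderiv_eq, fderiv_const_mul ((hB' u v).fun_mul (hB' w z)),
      fderiv_fun_mul (hB' u v) (hB' w z)] at h1
    simp only [hW.self_of_nhds, smul_apply, add_apply, smul_eq_mul] at h1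
    refine (mul_eq_zero.1 ?_).resolve_left hε
    simp only [covDerivForm]
    linear_combination h1
  obtain ⟨a, b, hab⟩ : ∃ a b, B y a b ≠ 0 := by
    by_contra! hc
    exact hne (by ext a b; simp [hc])
  -- Putting `(a, b)` in both pairs of slots gives `2 (∇ₜB)(a, b) B(a, b) = 0`; keeping it in the
  -- second pair only then disposes of all other components.
  have h1 : covDerivForm G B y t a b = 0 := by
    have := key a b a b
    have h2 : covDerivForm G B y t a b * B y a b = 0 := by linarith
    exact (mul_eq_zero.1 h2).resolve_right hab
  have h3 := key u v a b
  rw [h1, mul_zero, add_zero] at h3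
  exact (mul_eq_zero.1 h3).resolve_right hab

end LocalMetric


/-! ### Linear algebra of 2-forms of rank 2 on one vector space. -/

section TwoForms

variable {V : Type*} [AddCommGroup V] [Module ℝ V] [TopologicalSpace V] [IsTopologicalAddGroup V]
  [ContinuousSMul ℝ V] [T2Space V] [FiniteDimensional ℝ V]

theorem exists_linearEquiv_dual {g : V →L[ℝ] V →L[ℝ] ℝ}
    (hg : ∀ u, (∀ v, g u v = 0) → u = 0) :
    ∃ e : V ≃ₗ[ℝ] (V →L[ℝ] ℝ), ∀ u, e u = g u := by
  have hinj : Function.Injective g.toLinearMap := by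
    rw [injective_iff_map_eq_zero]
    intro u hu
    exact hg u fun v ↦ by
      have := congrArg (fun f : V →L[ℝ] ℝ ↦ f v) hu
      simpa using this
  have hd : Module.finrank ℝ V = Module.finrank ℝ (V →L[ℝ] ℝ) := by
    rw [← (LinearMap.toContinuousLinearMap (𝕜 := ℝ) (E := V) (F' := ℝ)).finrank_eq]
    exact (Subspace.dual_finrank_eq).symm
  exact ⟨LinearEquiv.ofInjectiveOfFinrankEq g.toLinearMap hinj hd, fun u ↦ rfl⟩

/-- A skew form `α` with `p ∧ α = 0` and `q ∧ α = 0` is a multiple of `p ∧ q`. -/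
theorem eq_wedge_mul_of_wedge_eq_zero {p q : V → ℝ} {α : V → V → ℝ} {e f : V}
    (hpe : p e = 1) (hqe : q e = 0) (hqf : q f = 1)
    (hα : ∀ a b, α a b = -α b a)
    (hp : ∀ a b c, p a * α b c + p b * α c a + p c * α a b = 0)
    (hq : ∀ a b c, q a * α b c + q b * α c a + q c * α a b = 0) (b c : V) :
    α b c = (p b * q c - p c * q b) * α e f := by
  -- Contracting `p ∧ α = 0` with `e` expresses `α` through `α(e, ·)`; contracting `q ∧ α = 0` with
  -- `e` and `f` reduces `α(e, ·)` to the number `α(e, f)`.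
  have h1 := hp e b c
  have h2 := hq f c e
  have h3 := hq f e b
  rw [hpe] at h1
  rw [hqf, hqe] at h2 h3
  have h4 := hα f c
  have h5 := hα b f
  linear_combination h1 - p b * h2 - p c * h3 + (p c * q b) * hα f e

/-- The restriction of `g` to `D` may be degenerate, even zero, so the dual vectors `e, f` are
sought in all of `V`. A basis of `D` is modified by elimination, with nondegeneracy on `V` supplying
each pivot. -/
theorem exists_dual_pair {g : V →L[ℝ] V →L[ℝ] ℝ} (hg : ∀ u, (∀ v, g u v = 0) → u = 0)
    {D : Submodule ℝ V} (hD : Module.finrank ℝ D = 2) :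
    ∃ p ∈ D, ∃ q ∈ D, ∃ e f, g p e = 1 ∧ g p f = 0 ∧ g q e = 0 ∧ g q f = 1 := by
  let b := Module.finBasisOfFinrankEq ℝ D hD
  have hb := b.linearIndependent
  have hb' : LinearIndependent ℝ ![b 0, b 1] := by
    convert hb using 1
    ext i
    fin_cases i <;> rfl
  have hp0 : (b 0 : V) ≠ 0 := by
    simpa using hb.ne_zero 0
  have hind : ∀ c : ℝ, (b 1 : V) - c • (b 0 : V) ≠ 0 := by
    intro c hc
    have h1 : (b 1) - c • (b 0) = 0 := Subtype.ext (by simpa using hc)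
    have h2 := LinearIndependent.pair_iff.1 hb' (-c) 1
      (by rw [← h1, neg_smul, one_smul, neg_add_eq_sub])
    exact one_ne_zero h2.2
  obtain ⟨e, he⟩ : ∃ e, g (b 0 : V) e ≠ 0 := by
    by_contra! hc
    exact hp0 (hg _ hc)
  set q : V := (b 1 : V) - (g (b 1 : V) e / g (b 0 : V) e) • (b 0 : V) with hq
  have hqe : g q e = 0 := by
    simp [hq, he]
  obtain ⟨f, hf⟩ : ∃ f, g q f ≠ 0 := by
    by_contra! hc
    exact hind _ (hg _ hc)
  refine ⟨b 0, (b 0).2, q, D.sub_mem (b 1).2 (D.smul_mem _ (b 0).2), (g (b 0 : V) e)⁻¹ • e,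
    (g q f)⁻¹ • (f - (g (b 0 : V) f / g (b 0 : V) e) • e), ?_, ?_, ?_, ?_⟩
  · simp [he]
  · simp [he]
  · simp [hqe]
  · simp [hqe, hf]

theorem finrank_span_pair_eq_two {N : Type*} [AddCommGroup N] [Module ℝ N] {a b : N}
    (h : ∀ s t : ℝ, s • a + t • b = 0 → s = 0 ∧ t = 0) :
    Module.finrank ℝ (Submodule.span ℝ {a, b}) = 2 := by
  have := finrank_span_eq_card (LinearIndependent.pair_iff.2 h)
  rwa [Matrix.range_cons_cons_empty, Fintype.card_fin] at this

/-- The algebraic core of the existence of a square root of `W`. -/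
theorem exists_square_root {g : V →L[ℝ] V →L[ℝ] ℝ} (hg : ∀ u, (∀ v, g u v = 0) → u = 0)
    {D : Submodule ℝ V} (hD : Module.finrank ℝ D = 2) {W : V → V → V → V → ℝ}
    (hskew : ∀ u v w z, W u v w z = -W u v z w) (hpair : ∀ u v w z, W u v w z = W w z u v)
    (hne : ∃ u v w z, W u v w z ≠ 0)
    (hDW : ∀ u ∈ D, ∀ v v' a b c,
      g u a * W v v' b c + g u b * W v v' c a + g u c * W v v' a b = 0) :
    ∃ (B : V →L[ℝ] V →L[ℝ] ℝ) (ε : ℝ), (ε = 1 ∨ ε = -1) ∧ (∀ u, B u u = 0) ∧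
      Module.finrank ℝ (LinearMap.range B.toLinearMap) = 2 ∧
      ∀ u v w z, W u v w z = ε * (B u v * B w z) := by
  obtain ⟨p, hpD, q, hqD, e, f, hpe, hpf, hqe, hqf⟩ := exists_dual_pair hg hD
  have h1 : ∀ u v w z, W u v w z = (g p w * g q z - g p z * g q w) * W u v e f := fun u v w z ↦
    eq_wedge_mul_of_wedge_eq_zero hpe hqe hqf (hskew u v) (hDW p hpD u v) (hDW q hqD u v) w z
  set c := W e f e f with hc
  have h2 : ∀ u v w z, W u v w z =
      c * ((g p u * g q v - g p v * g q u) * (g p w * g q z - g p z * g q w)) := by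
    intro u v w z
    -- Decomposability in the last pair passes to the first pair by pair symmetry.
    rw [h1 u v w z, hpair u v e f, h1 e f u v]
    ring
  have hc0 : c ≠ 0 := by
    rintro h0
    obtain ⟨u, v, w, z, h⟩ := hne
    exact h (by rw [h2, h0, zero_mul])
  set k := Real.sqrt |c| with hk
  have hk2 : k * k = |c| := Real.mul_self_sqrt (abs_nonneg c)
  have hk0 : k ≠ 0 := (Real.sqrt_pos.2 (abs_pos.2 hc0)).ne'
  let B : V →L[ℝ] V →L[ℝ] ℝ := k • ((g p).smulRight (g q) - (g q).smulRight (g p))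
  have hB : ∀ u, B u = k • (g p u • g q - g q u • g p) := fun u ↦ rfl
  have hB' : ∀ u v, B u v = k * (g p u * g q v - g p v * g q u) := by
    intro u v
    rw [hB]
    simp only [smul_apply, sub_apply, smul_eq_mul]
    ring
  refine ⟨B, SignType.sign c, ?_, ?_, ?_, ?_⟩
  · rcases hc0.lt_or_gt with h | h
    · right; simp [h]
    · left; simp [h]
  · intro u
    rw [hB']
    ring
  · have hr : LinearMap.range B.toLinearMap = Submodule.span ℝ {g p, g q} := by
      apply le_antisymm
      · rintro _ ⟨u, rfl⟩
        rw [Submodule.mem_span_pair]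
        refine ⟨-(k * g q u), k * g p u, ?_⟩
        change _ = B u
        rw [hB, smul_sub, smul_smul, smul_smul, neg_smul]
        abel
      · rw [Submodule.span_le]
        rintro _ (rfl | rfl)
        · refine ⟨-k⁻¹ • f, ?_⟩
          change B _ = _
          rw [map_smul, hB, hpf, hqf, smul_smul]
          simp [hk0]
        · refine ⟨k⁻¹ • e, ?_⟩
          change B _ = _
          rw [map_smul, hB, hpe, hqe, smul_smul]
          simp [hk0]
    rw [hr]
    refine finrank_span_pair_eq_two fun s t hst ↦ ?_
    have he := congrArg (fun φ : V →L[ℝ] ℝ ↦ φ e) hst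
    have hf := congrArg (fun φ : V →L[ℝ] ℝ ↦ φ f) hst
    simp [hpe, hpf, hqe, hqf] at he hf
    exact ⟨he, hf⟩
  · intro u v w z
    have hs : (SignType.sign c : ℝ) * |c| = c := sign_mul_abs c
    rw [h2, hB', hB']
    conv_lhs => rw [← hs, ← hk2]
    ring

variable {B : V →L[ℝ] V →L[ℝ] ℝ}

theorem exists_apply_ne_zero_of_finrank_range
    (hr : Module.finrank ℝ (LinearMap.range B.toLinearMap) = 2) : ∃ e f, B e f ≠ 0 := by
  by_contra! hc
  have : B.toLinearMap = 0 := by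
    ext u v
    exact hc u v
  rw [this, LinearMap.range_zero, finrank_bot] at hr
  exact absurd hr (by norm_num)

/-- A `2`-form of rank `2` is decomposable. -/
theorem two_form_decomposable (hB : ∀ u, B u u = 0)
    (hr : Module.finrank ℝ (LinearMap.range B.toLinearMap) = 2) {e f : V} (hef : B e f ≠ 0)
    (u v : V) : B e f * B u v = B u f * B e v - B u e * B f v := by
  have hfe : B f e = -B e f := by
    have := hB (e + f)
    simp only [map_add, add_apply, hB] at this
    linarith
  have hle : Submodule.span ℝ {B e, B f} ≤ LinearMap.range B.toLinearMap := by
    rw [Submodule.span_le]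
    rintro _ (rfl | rfl)
    · exact ⟨e, rfl⟩
    · exact ⟨f, rfl⟩
  have hsp : Module.finrank ℝ (Submodule.span ℝ {B e, B f}) = 2 := by
    refine finrank_span_pair_eq_two fun s t hst ↦ ?_
    have he := congrArg (fun φ : V →L[ℝ] ℝ ↦ φ e) hst
    have hf := congrArg (fun φ : V →L[ℝ] ℝ ↦ φ f) hst
    simp only [add_apply, smul_apply, smul_eq_mul, hB, hfe, zero_apply, mul_zero, zero_add,
      add_zero, mul_neg, neg_eq_zero, mul_eq_zero, hef, or_false] at he hf
    exact ⟨hf, he⟩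
  -- As `B(e, f) ≠ 0`, the covectors `B e` and `B f` are independent, so they already fill the
  -- two-dimensional range.
  have heq := Submodule.eq_of_le_of_finrank_eq hle (hsp.trans hr.symm)
  have hu : B u ∈ Submodule.span ℝ {B e, B f} := by
    rw [heq]; exact ⟨u, rfl⟩
  obtain ⟨s, t, hst⟩ := Submodule.mem_span_pair.1 hu
  rw [← hst]
  simp only [add_apply, smul_apply, smul_eq_mul, hB, hfe]
  ring

/-- The vectors `w` with `g(w, ·) ∧ B = 0` form the image of `B`. -/
theorem wedge_eq_zero_iff_mem_image {g : V →L[ℝ] V →L[ℝ] ℝ} (hB : ∀ u, B u u = 0)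
    (hr : Module.finrank ℝ (LinearMap.range B.toLinearMap) = 2) {ε : ℝ} (hε : ε ≠ 0)
    {W : V → V → V → V → ℝ} (hW : ∀ u v w z, W u v w z = ε * (B u v * B w z)) (w : V) :
    (∃ u, g w = B u) ↔ ∀ v v' a b c,
      g w a * W v v' b c + g w b * W v v' c a + g w c * W v v' a b = 0 := by
  obtain ⟨e, f, hef⟩ := exists_apply_ne_zero_of_finrank_range hr
  have hskew : ∀ a b, B a b = -B b a := by
    intro a b
    have := hB (a + b)
    simp only [map_add, add_apply, hB] at this
    linarith
  have hd := two_form_decomposable hB hr hef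
  constructor
  · rintro ⟨u, hu⟩ v v' a b c
    -- In this form `B` is a multiple of `B(·, e) ∧ B(·, f)`, and `B(u, ·)` lies in the span of the
    -- two factors, so the wedge vanishes identically.
    have hd' : ∀ a b, B a b = (B e f)⁻¹ * (B a e * B b f - B a f * B b e) := by
      intro a b
      rw [eq_inv_mul_iff_mul_eq₀ hef, hd a b, hskew e b, hskew f b]
      ring
    rw [hu, hW, hW, hW, hd' u a, hd' u b, hd' u c, hd' b c, hd' c a, hd' a b]
    ring
  · intro h
    -- The preimage is found by solving the hypothesis at `(e, f, a, e, f)` for `g(w, a)`.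
    refine ⟨(B e f)⁻¹ • (g w f • e - g w e • f), ?_⟩
    ext a
    have h1 := h e f a e f
    rw [hW, hW, hW] at h1
    have h2 : (ε * B e f) * (g w a * B e f + g w e * B f a + g w f * B a e) = 0 := by
      linear_combination h1
    have h3 := (mul_eq_zero.1 h2).resolve_left (mul_ne_zero hε hef)
    simp only [map_smul, map_sub, smul_apply, sub_apply, smul_eq_mul]
    rw [eq_inv_mul_iff_mul_eq₀ hef]
    rw [hskew a e] at h3
    linear_combination h3

theorem finrank_eq_two_of_mem_iff {g : V →L[ℝ] V →L[ℝ] ℝ} (hg : ∀ u, (∀ v, g u v = 0) → u = 0)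
    (hr : Module.finrank ℝ (LinearMap.range B.toLinearMap) = 2) {D : Submodule ℝ V}
    (hD : ∀ w, w ∈ D ↔ ∃ u, g w = B u) : Module.finrank ℝ D = 2 := by
  obtain ⟨e, he⟩ := exists_linearEquiv_dual hg
  suffices hmap : D.map (e : V →ₗ[ℝ] (V →L[ℝ] ℝ)) = LinearMap.range B.toLinearMap by
    rw [← hr, ← hmap, LinearEquiv.finrank_map_eq]
  ext φ
  constructor
  · rintro ⟨w, hw, rfl⟩
    obtain ⟨u, hu⟩ := (hD w).1 hw
    exact ⟨u, by change B u = e w; rw [he, hu]⟩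
  · rintro ⟨u, rfl⟩
    exact ⟨e.symm (B u), (hD _).2 ⟨u, by rw [← he, e.apply_symm_apply]⟩, e.apply_symm_apply _⟩

/-- The common tensor at `(e, f, e, f)` is `ε B(e, f)²`, which has the sign of `ε`. With `ε' = ε`,
the values `B(e, f)` and `B'(e, f)` agree up to sign, and fixing `(e, f)` in one pair spreads that
sign to all arguments. -/
theorem square_root_unique {B' : V →L[ℝ] V →L[ℝ] ℝ} {ε ε' : ℝ} (hε : ε = 1 ∨ ε = -1)
    (hε' : ε' = 1 ∨ ε' = -1) {e f : V} (hef : B e f ≠ 0)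
    (h : ∀ u v w z, ε * (B u v * B w z) = ε' * (B' u v * B' w z)) :
    ε' = ε ∧ (B' = B ∨ B' = -B) := by
  have h1 := h e f e f
  have hpos : 0 < B e f * B e f := mul_self_pos.2 hef
  have hnn : 0 ≤ B' e f * B' e f := mul_self_nonneg _
  have hee : ε' = ε := by
    rcases hε with rfl | rfl <;> rcases hε' with rfl | rfl <;> first | rfl | (exfalso; linarith)
  subst hee
  have h0 : ε' ≠ 0 := by rcases hε with rfl | rfl <;> norm_num
  refine ⟨rfl, ?_⟩
  have h2 : ∀ u v, B u v * B e f = B' u v * B' e f := fun u v ↦ mul_left_cancel₀ h0 (h u v e f)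
  rcases mul_self_eq_mul_self_iff.1 (h2 e f) with h3 | h3
  · left
    ext u v
    have := h2 u v
    rw [← h3] at this
    exact (mul_right_cancel₀ hef this).symm
  · right
    ext u v
    have := h2 u v
    rw [show B' e f = -B e f by linarith] at this
    have h4 : B u v * B e f = (-B' u v) * B e f := by linarith
    have h5 := mul_right_cancel₀ hef h4
    simp [h5]

end TwoForms


/-! ### Passing between the manifold and its coordinate charts. -/

section Charts

open Topology

variable {n : ℕ} {M : Type*} [TopologicalSpace M] [ChartedSpace (Coord n) M]
  [IsManifold (𝓡 n) ∞ M]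

instance instIsManifoldOneOfInfty : IsManifold (𝓡 n) 1 M := IsManifold.of_le (n := ∞) (by simp)

/-- The differential at `x` of the chart around `x₀`. -/
def chartD (x₀ x : M) : TangentSpace (𝓡 n) x →L[ℝ] Coord n :=
  mfderiv (𝓡 n) 𝓘(ℝ, Coord n) (extChartAt (𝓡 n) x₀) x

/-- The coordinate frame at `x` of the chart around `x₀`, as a linear map. -/
def chartFrame (x₀ x : M) : Coord n →L[ℝ] TangentSpace (𝓡 n) x :=
  mfderiv 𝓘(ℝ, Coord n) (𝓡 n) (extChartAt (𝓡 n) x₀).symm (extChartAt (𝓡 n) x₀ x)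

/-- All tangent spaces are by definition the model space, so one coordinate vector makes sense at
two base points that are only provably equal. `BilinField.apply_congr` plays the same role. -/
theorem chartD_congr (x₀ : M) {p q : M} (h : p = q) (u : Coord n) :
    chartD x₀ p u = chartD x₀ q u := by
  subst h; rfl

theorem chartFrame_chartD {x₀ x : M} (hx : x ∈ (extChartAt (𝓡 n) x₀).source)
    (u : TangentSpace (𝓡 n) x) : chartFrame x₀ x (chartD x₀ x u) = u := by
  have := mfderivWithin_extChartAt_symm_comp_mfderiv_extChartAt' (I := 𝓡 n) hx
  rw [ModelWithCorners.range_eq_univ, mfderivWithin_univ] at this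
  exact congrArg (fun f : TangentSpace (𝓡 n) x →L[ℝ] TangentSpace (𝓡 n) x ↦ f u) this

theorem chartD_chartFrame {x₀ x : M} (hx : x ∈ (extChartAt (𝓡 n) x₀).source) (u : Coord n) :
    chartD x₀ x (chartFrame x₀ x u) = u := by
  have := mfderiv_extChartAt_comp_mfderivWithin_extChartAt_symm' (I := 𝓡 n) hx
  rw [ModelWithCorners.range_eq_univ, mfderivWithin_univ] at this
  exact congrArg (fun f : Coord n →L[ℝ] Coord n ↦ f u) this

namespace BilinField

theorem apply_congr (B : BilinField n M) {p q : M} (h : p = q) (u v : Coord n) :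
    B p u v = B q u v := by
  subst h; rfl

theorem inChart_apply (B : BilinField n M) {x₀ x : M} (hx : x ∈ (extChartAt (𝓡 n) x₀).source)
    (u v : Coord n) :
    B.inChart x₀ (extChartAt (𝓡 n) x₀ x) u v = B x (chartFrame x₀ x u) (chartFrame x₀ x v) :=
  B.apply_congr ((extChartAt (𝓡 n) x₀).left_inv hx) _ _

theorem inChart_apply_chartD (B : BilinField n M) {x₀ x : M}
    (hx : x ∈ (extChartAt (𝓡 n) x₀).source) (u v : TangentSpace (𝓡 n) x) :
    B.inChart x₀ (extChartAt (𝓡 n) x₀ x) (chartD x₀ x u) (chartD x₀ x v) = B x u v := by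
  rw [B.inChart_apply hx, chartFrame_chartD hx, chartFrame_chartD hx]

/-- The bundle trivialization at `x₀` reads a form at `x` by evaluating it on the coordinate frame
of the chart around `x₀`, which is exactly `inChart`. -/
theorem smoothOn_iff (B : BilinField n M) {x₀ : M} {U : Set M} (hU : IsOpen U)
    (hUs : U ⊆ (chartAt (Coord n) x₀).source) :
    B.SmoothOn U ↔ ContMDiffOn (𝓡 n) 𝓘(ℝ, Coord n →L[ℝ] Coord n →L[ℝ] ℝ) ∞
      (fun x ↦ B.inChart x₀ (extChartAt (𝓡 n) x₀ x)) U := by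
  have h1 := (trivializationAt (Coord n →L[ℝ] Coord n →L[ℝ] ℝ)
    (fun x : M ↦ TangentSpace (𝓡 n) x →L[ℝ] TangentSpace (𝓡 n) x →L[ℝ] ℝ)
    x₀).contMDiffOn_section_iff (IB := 𝓡 n) (n := ∞) (s := B) hU (by
      intro x hx
      simpa using hUs hx)
  rw [BilinField.SmoothOn, h1]
  refine contMDiffOn_congr fun x hx ↦ ?_
  have hx' := hUs hx
  have e2 : (trivializationAt (Coord n) (TangentSpace (𝓡 n)) x₀).symmL ℝ x = chartFrame x₀ x := by
    have e2 := TangentBundle.symmL_trivializationAt (I := 𝓡 n) (x₀ := x₀) (x := x) hx'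
    rw [ModelWithCorners.range_eq_univ, mfderivWithin_univ] at e2
    exact e2
  ext u v
  rw [B.inChart_apply (by simpa using hx'), hom_trivializationAt_apply]
  have e3 := inCoordinates_apply_eq₂ (𝕜 := ℝ) (F₁ := Coord n) (F₂ := Coord n) (F₃ := ℝ)
    (E₁ := fun x : M ↦ TangentSpace (𝓡 n) x) (E₂ := fun x : M ↦ TangentSpace (𝓡 n) x)
    (E₃ := Bundle.Trivial M ℝ) (x₀ := x₀) (x := x) (ϕ := B x) (v := u) (w := v)
    (by simpa using hx') (by simpa using hx') (by simp)
  refine e3.trans ?_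
  have hb : x ∈ (trivializationAt (Coord n) (TangentSpace (𝓡 n)) x₀).baseSet := by
    simpa using hx'
  rw [← e2]
  simp [Bundle.Trivialization.symmL_apply _ hb]

theorem SmoothOn.contDiffAt_inChart {B : BilinField n M} {U : Set M} (hB : B.SmoothOn U)
    (hU : IsOpen U) {x₀ : M} {y : Coord n} (hy : y ∈ (extChartAt (𝓡 n) x₀).target)
    (hyU : (extChartAt (𝓡 n) x₀).symm y ∈ U) : ContDiffAt ℝ ∞ (B.inChart x₀) y := by
  set p := (extChartAt (𝓡 n) x₀).symm y with hp
  have hs : IsOpen (chartAt (Coord n) x₀).source := (chartAt (Coord n) x₀).open_source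
  have hps : p ∈ (chartAt (Coord n) x₀).source := by
    rw [← extChartAt_source (𝓡 n)]
    exact (extChartAt (𝓡 n) x₀).map_target hy
  have h1 := (B.smoothOn_iff (x₀ := x₀) (hU.inter hs) Set.inter_subset_right).1
    (hB.mono Set.inter_subset_left)
  have h2 := (h1 p ⟨hyU, hps⟩).contMDiffAt ((hU.inter hs).mem_nhds ⟨hyU, hps⟩)
  have h3 : ContMDiffAt 𝓘(ℝ, Coord n) (𝓡 n) ∞ (extChartAt (𝓡 n) x₀).symm y :=
    (contMDiffOn_extChartAt_symm x₀ y hy).contMDiffAt (extChartAt_target_mem_nhds' hy)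
  have h4 := h2.comp y h3
  rw [← contMDiffAt_iff_contDiffAt]
  refine h4.congr_of_eventuallyEq ?_
  filter_upwards [extChartAt_target_mem_nhds' hy] with z hz
  exact (congrArg (B.inChart x₀) ((extChartAt (𝓡 n) x₀).right_inv hz)).symm

theorem smoothOn_of_contDiffAt_inChart {B : BilinField n M} {U : Set M} {x₀ : M} (hU : IsOpen U)
    (hUs : U ⊆ (chartAt (Coord n) x₀).source)
    (h : ∀ x ∈ U, ContDiffAt ℝ ∞ (B.inChart x₀) (extChartAt (𝓡 n) x₀ x)) : B.SmoothOn U := by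
  rw [B.smoothOn_iff hU hUs]
  intro x hx
  exact ((h x hx).contMDiffAt.comp x (contMDiffAt_extChartAt' (hUs hx))).contMDiffWithinAt

end BilinField

theorem isMetricOn_inChart (g : PseudoRiemannianMetric n M) (x₀ : M) :
    LocalMetric.IsMetricOn (g.val.inChart x₀) (extChartAt (𝓡 n) x₀).target where
  isOpen := isOpen_extChartAt_target x₀
  contDiffOn y hy :=
    (g.smooth.contDiffAt_inChart isOpen_univ hy (Set.mem_univ _)).contDiffWithinAt
  symm y _ u v := g.symm _ _ _
  nondegenerate y hy u hu := by
    obtain ⟨x, hxs, rfl⟩ := (extChartAt (𝓡 n) x₀).surjOn hy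
    have h0 : chartFrame x₀ x u = 0 := g.nondegenerate x _ fun v ↦ by
      rw [← g.val.inChart_apply_chartD hxs, chartD_chartFrame hxs]
      exact hu _
    rw [← chartD_chartFrame hxs u, h0, map_zero]

theorem weylAt_eq_chartD (g : PseudoRiemannianMetric n M) (x : M) (u v w z : TangentSpace (𝓡 n) x) :
    g.weylAt x u v w z = LocalMetric.weyl (g.val.inChart x) (extChartAt (𝓡 n) x x)
      (chartD x x u) (chartD x x v) (chartD x x w) (chartD x x z) := rfl

/-- The transition map from the chart around `x₀` to the chart around `x₁`. -/
def transition (x₀ x₁ : M) : Coord n → Coord n :=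
  fun z ↦ extChartAt (𝓡 n) x₁ ((extChartAt (𝓡 n) x₀).symm z)

theorem fderiv_transition {x₀ x₁ x : M} (hx₀ : x ∈ (extChartAt (𝓡 n) x₀).source)
    (hx₁ : x ∈ (extChartAt (𝓡 n) x₁).source) (u : Coord n) :
    fderiv ℝ (transition x₀ x₁) (extChartAt (𝓡 n) x₀ x) u = chartD x₁ x (chartFrame x₀ x u) := by
  have hy := (extChartAt (𝓡 n) x₀).map_source hx₀
  have h1 : MDifferentiableAt 𝓘(ℝ, Coord n) (𝓡 n) (extChartAt (𝓡 n) x₀).symm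
      (extChartAt (𝓡 n) x₀ x) := by
    have := mdifferentiableWithinAt_extChartAt_symm hy
    rwa [ModelWithCorners.range_eq_univ, mdifferentiableWithinAt_univ] at this
  have hxe := (extChartAt (𝓡 n) x₀).left_inv hx₀
  have h2 : MDifferentiableAt (𝓡 n) 𝓘(ℝ, Coord n) (extChartAt (𝓡 n) x₁) x :=
    mdifferentiableAt_extChartAt (by rwa [extChartAt_source] at hx₁)
  have h3 := mfderiv_comp_of_eq (x := extChartAt (𝓡 n) x₀ x) h2 h1 hxe
  rw [mfderiv_eq_fderiv] at h3
  exact (congrArg (fun f : Coord n →L[ℝ] Coord n ↦ f u) h3).trans (chartD_congr x₁ hxe _)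

/-- Both coordinate metrics are pullbacks of the same `g`, hence they correspond under the change of
coordinates. -/
theorem isIsometryOn_transition (g : PseudoRiemannianMetric n M) (x₀ x₁ : M) :
    LocalMetric.IsIsometryOn (g.val.inChart x₀) (g.val.inChart x₁)
      ((extChartAt (𝓡 n) x₀).target ∩
        (extChartAt (𝓡 n) x₀).symm ⁻¹' (extChartAt (𝓡 n) x₁).source)
      (extChartAt (𝓡 n) x₁).target (transition x₀ x₁) where
  metric :=
    have h := isMetricOn_inChart g x₀
    have ho : IsOpen ((extChartAt (𝓡 n) x₀).target ∩
        (extChartAt (𝓡 n) x₀).symm ⁻¹' (extChartAt (𝓡 n) x₁).source) :=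
      (continuousOn_extChartAt_symm x₀).isOpen_inter_preimage h.isOpen
        (isOpen_extChartAt_source x₁)
    { isOpen := ho
      contDiffOn := h.contDiffOn.mono Set.inter_subset_left
      symm := fun y hy ↦ h.symm y hy.1
      nondegenerate := fun y hy ↦ h.nondegenerate y hy.1 }
  metric' := isMetricOn_inChart g x₁
  contDiffOn := by
    rw [← contMDiffOn_iff_contDiffOn]
    have h1 := contMDiffOn_extChartAt (I := 𝓡 n) (n := ∞) (x := x₁)
    rw [← extChartAt_source (𝓡 n)] at h1
    exact h1.comp ((contMDiffOn_extChartAt_symm x₀).mono Set.inter_subset_left) fun y hy ↦ hy.2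
  mapsTo y hy := (extChartAt (𝓡 n) x₁).map_source hy.2
  pullback y hy u v := by
    obtain ⟨hy, hy1⟩ := hy
    obtain ⟨x, hxs, rfl⟩ := (extChartAt (𝓡 n) x₀).surjOn hy
    rw [Set.mem_preimage, (extChartAt (𝓡 n) x₀).left_inv hxs] at hy1
    rw [fderiv_transition hxs hy1, fderiv_transition hxs hy1, transition,
      (extChartAt (𝓡 n) x₀).left_inv hxs, g.val.inChart_apply_chartD hy1, g.val.inChart_apply hxs]

/-- The Weyl tensor can be computed in any chart. -/
theorem weylAt_eq (g : PseudoRiemannianMetric n M) {x₀ x : M}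
    (hx : x ∈ (extChartAt (𝓡 n) x₀).source) (u v w z : TangentSpace (𝓡 n) x) :
    g.weylAt x u v w z = LocalMetric.weyl (g.val.inChart x₀) (extChartAt (𝓡 n) x₀ x)
      (chartD x₀ x u) (chartD x₀ x v) (chartD x₀ x w) (chartD x₀ x z) := by
  have hx' := mem_extChartAt_source (I := 𝓡 n) x
  have hy : extChartAt (𝓡 n) x₀ x ∈ (extChartAt (𝓡 n) x₀).target ∩
      (extChartAt (𝓡 n) x₀).symm ⁻¹' (extChartAt (𝓡 n) x).source :=
    ⟨(extChartAt (𝓡 n) x₀).map_source hx, by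
      rwa [Set.mem_preimage, (extChartAt (𝓡 n) x₀).left_inv hx]⟩
  rw [weylAt_eq_chartD, (isIsometryOn_transition g x₀ x).weyl_eq hy]
  simp only [fderiv_transition hx hx', chartFrame_chartD hx]
  rw [transition, (extChartAt (𝓡 n) x₀).left_inv hx]

end Charts


/-! ### Square roots of the Weyl tensor on the manifold. -/

namespace PseudoRiemannianMetric

variable {n : ℕ} {M : Type*} [TopologicalSpace M] [ChartedSpace (Coord n) M]
  [IsManifold (𝓡 n) ∞ M] (g : PseudoRiemannianMetric n M)

instance instFiniteDimensionalTangent (x : M) : FiniteDimensional ℝ (TangentSpace (𝓡 n) x) :=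
  inferInstanceAs (FiniteDimensional ℝ (Coord n))

instance instT2SpaceTangent (x : M) : T2Space (TangentSpace (𝓡 n) x) :=
  inferInstanceAs (T2Space (Coord n))

theorem finrank_tangent (x : M) : Module.finrank ℝ (TangentSpace (𝓡 n) x) = n :=
  (finrank_euclideanSpace_fin : Module.finrank ℝ (Coord n) = n)

theorem weylAt_skew (x : M) (u v w z : TangentSpace (𝓡 n) x) :
    g.weylAt x u v w z = -g.weylAt x u v z w :=
  (isMetricOn_inChart g x).weyl_skew (mem_extChartAt_target x) _ _ _ _

theorem weylAt_pair_symm (x : M) (u v w z : TangentSpace (𝓡 n) x) :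
    g.weylAt x u v w z = g.weylAt x w z u v :=
  (isMetricOn_inChart g x).weyl_pair_symm (mem_extChartAt_target x) _ _ _ _

variable {g}

theorem exists_pointwise_square_root (hn : 4 ≤ n) (hD : g.OlszakDimEq 2) (x : M) :
    ∃ (B : TangentSpace (𝓡 n) x →L[ℝ] TangentSpace (𝓡 n) x →L[ℝ] ℝ) (ε : ℝ), (ε = 1 ∨ ε = -1) ∧
      (∀ u, B u u = 0) ∧ Module.finrank ℝ (LinearMap.range B.toLinearMap) = 2 ∧
      ∀ u v w z, g.weylAt x u v w z = ε * (B u v * B w z) := by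
  refine exists_square_root (g.nondegenerate x) (hD x) (g.weylAt_skew x) (g.weylAt_pair_symm x)
    ?_ fun u hu ↦ hu
  by_contra! h0
  -- If `W` vanished at `x`, the fibre would have dimension `n ≥ 4` instead of 2.
  have htop : g.olszak x = ⊤ := by
    rw [eq_top_iff]
    intro u _ v v' a b c
    simp [h0]
  have := hD x
  rw [htop, finrank_top, finrank_tangent] at this
  omega

/-- Extend `a, b` to nearby points with constant components in one chart; the value of `W` on them
is then continuous. -/
theorem isOpen_setOf_weylAt_pos (g : PseudoRiemannianMetric n M) (c : ℝ) :
    IsOpen {x : M | ∃ a b, 0 < c * g.weylAt x a b a b} := by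
  rw [isOpen_iff_mem_nhds]
  rintro x ⟨a, b, hab⟩
  rw [weylAt_eq_chartD] at hab
  have hc : ContinuousAt (fun p ↦ c * LocalMetric.weyl (g.val.inChart x) (extChartAt (𝓡 n) x p)
      (chartD x x a) (chartD x x b) (chartD x x a) (chartD x x b)) x := by
    refine continuousAt_const.mul ?_
    exact (((isMetricOn_inChart g x).contDiffAt_weyl (mem_extChartAt_target x) _ _ _
      _).continuousAt).comp (continuousAt_extChartAt x)
  filter_upwards [hc.eventually (lt_mem_nhds hab), extChartAt_source_mem_nhds (I := 𝓡 n) x]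
    with p hp hps
  refine ⟨chartFrame x p (chartD x x a), chartFrame x p (chartD x x b), ?_⟩
  simpa only [weylAt_eq g hps, chartD_chartFrame hps] using hp

/-- Since `W(a, b, a, b) = ε B(a, b)²`, the points of each sign form a set covered by
`isOpen_setOf_weylAt_pos`; the two sets are complementary, hence clopen. -/
theorem exists_global_sign [ConnectedSpace M] (hn : 4 ≤ n) (hD : g.OlszakDimEq 2) :
    ∃ ε : ℝ, (ε = 1 ∨ ε = -1) ∧ ∀ x : M,
      ∃ B : TangentSpace (𝓡 n) x →L[ℝ] TangentSpace (𝓡 n) x →L[ℝ] ℝ,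
      (∀ u, B u u = 0) ∧ Module.finrank ℝ (LinearMap.range B.toLinearMap) = 2 ∧
      ∀ u v w z, g.weylAt x u v w z = ε * (B u v * B w z) := by
  choose B ε hε hB hr hW using exists_pointwise_square_root (g := g) hn hD
  have hset : ∀ c : ℝ, (c = 1 ∨ c = -1) →
      {x : M | ε x = c} = {x : M | ∃ a b, 0 < c * g.weylAt x a b a b} := by
    intro c hc
    ext x
    obtain ⟨e, f, hef⟩ := exists_apply_ne_zero_of_finrank_range (hr x)
    have hpos : 0 < B x e f * B x e f := mul_self_pos.2 hef
    simp only [Set.mem_ofPred_eq, hW]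
    constructor
    · rintro rfl
      refine ⟨e, f, ?_⟩
      rcases hε x with h | h <;> rw [h] <;> linarith
    · rintro ⟨a, b, hab⟩
      have hnn := mul_self_nonneg (B x a b)
      rcases hε x with h | h <;> rcases hc with h' | h' <;> rw [h, h'] at hab <;>
        first | (exfalso; linarith) | rw [h, h']
  have hcl : IsClopen {x : M | ε x = 1} := by
    constructor
    · rw [← isOpen_compl_iff]
      have : {x : M | ε x = 1}ᶜ = {x : M | ε x = -1} := by
        ext x
        rcases hε x with h | h <;> simp [h] <;> norm_num
      rw [this, hset _ (Or.inr rfl)]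
      exact isOpen_setOf_weylAt_pos g _
    · rw [hset _ (Or.inl rfl)]
      exact isOpen_setOf_weylAt_pos g _
  rcases isClopen_iff.1 hcl with h | h
  · refine ⟨-1, Or.inr rfl, fun x ↦ ⟨B x, hB x, hr x, fun u v w z ↦ ?_⟩⟩
    have hx : x ∉ {x : M | ε x = 1} := by rw [h]; exact Set.notMem_empty x
    rw [hW, (hε x).resolve_left hx]
  · refine ⟨1, Or.inl rfl, fun x ↦ ⟨B x, hB x, hr x, fun u v w z ↦ ?_⟩⟩
    have hx : x ∈ {x : M | ε x = 1} := by rw [h]; trivial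
    rw [hW, show ε x = 1 from hx]

/-- A smooth field `η` of bilinear forms with `W = ε η ⊗ η ≠ 0` is parallel if `W` is. -/
theorem isParallelOn_of_weylAt_eq (hW : g.HasParallelWeyl) {ε : ℝ} (hε : ε ≠ 0) {U : Set M}
    (hU : IsOpen U) {η : BilinField n M} (hη : η.SmoothOn U)
    (hηW : ∀ x ∈ U, ∀ u v w z, g.weylAt x u v w z = ε * (η x u v * η x w z))
    (hne : ∀ x ∈ U, η x ≠ 0) : g.IsParallelOn η U := by
  intro x₀ y hy hyU
  refine LocalMetric.covDerivForm_eq_zero hε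
    ((hη.contDiffAt_inChart hU hy hyU).differentiableAt (by simp)) ?_ (hW x₀ y hy) ?_
  · have h1 : (extChartAt (𝓡 n) x₀).target ∩ (extChartAt (𝓡 n) x₀).symm ⁻¹' U ∈ nhds y :=
      ((continuousOn_extChartAt_symm x₀).isOpen_inter_preimage
        (isOpen_extChartAt_target x₀) hU).mem_nhds ⟨hy, hyU⟩
    filter_upwards [h1] with p hp u v w z
    obtain ⟨hp, hpU⟩ := hp
    obtain ⟨x, hx, rfl⟩ := (extChartAt (𝓡 n) x₀).surjOn hp
    rw [Set.mem_preimage, (extChartAt (𝓡 n) x₀).left_inv hx] at hpU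
    have := hηW x hpU (chartFrame x₀ x u) (chartFrame x₀ x v) (chartFrame x₀ x w)
      (chartFrame x₀ x z)
    rw [weylAt_eq g hx] at this
    simpa only [chartD_chartFrame hx, ← η.inChart_apply hx] using this
  · obtain ⟨x, hx, rfl⟩ := (extChartAt (𝓡 n) x₀).surjOn hy
    rw [(extChartAt (𝓡 n) x₀).left_inv hx] at hyU
    intro h0
    refine hne x hyU ?_
    ext u v
    rw [← η.inChart_apply_chartD hx, h0]
    rfl

/-- Near every point, pointwise square roots of `W` can be changed by signs to form a smooth
field. -/
theorem exists_smooth_sign_change {ε : ℝ} (hε : ε = 1 ∨ ε = -1) {Ω : BilinField n M}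
    (hr : ∀ x, Module.finrank ℝ (LinearMap.range (Ω x).toLinearMap) = 2)
    (hW : ∀ x u v w z, g.weylAt x u v w z = ε * (Ω x u v * Ω x w z)) (x₀ : M) :
    ∃ U : Set M, IsOpen U ∧ x₀ ∈ U ∧ ∃ η : BilinField n M, η.SmoothOn U ∧
      ∀ x ∈ U, Ω x = η x ∨ Ω x = -η x := by
  have hεε : ε * ε = 1 := by rcases hε with rfl | rfl <;> norm_num
  obtain ⟨e, f, hef⟩ := exists_apply_ne_zero_of_finrank_range (hr x₀)
  set a := chartD x₀ x₀ e
  set b := chartD x₀ x₀ f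
  set G := g.val.inChart x₀
  set φ := extChartAt (𝓡 n) x₀ with hφ
  have hG : LocalMetric.IsMetricOn G φ.target := isMetricOn_inChart g x₀
  set F : Coord n → ℝ := fun y ↦ ε * LocalMetric.weyl G y a b a b
  have hFd : ∀ y ∈ φ.target, ContDiffAt ℝ ∞ F y := fun y hy ↦
    contDiffAt_const.mul (hG.contDiffAt_weyl hy _ _ _ _)
  have hWl : ∀ x ∈ φ.source, ∀ u v w z, LocalMetric.weyl G (φ x) u v w z =
      ε * (Ω x (chartFrame x₀ x u) (chartFrame x₀ x v)
        * Ω x (chartFrame x₀ x w) (chartFrame x₀ x z)) := by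
    intro x hx u v w z
    rw [← hW, weylAt_eq g hx]
    simp only [chartD_chartFrame hx, G, φ]
  have hF : ∀ x ∈ φ.source, F (φ x) =
      Ω x (chartFrame x₀ x a) (chartFrame x₀ x b)
        * Ω x (chartFrame x₀ x a) (chartFrame x₀ x b) := by
    intro x hx
    simp only [F, hWl x hx, ← mul_assoc, hεε, one_mul]
  have hx₀ : x₀ ∈ φ.source := mem_extChartAt_source x₀
  have hFo : IsOpen (φ.target ∩ F ⁻¹' Set.Ioi 0) :=
    ContinuousOn.isOpen_inter_preimage
      (fun y hy ↦ (hFd y hy).continuousAt.continuousWithinAt) hG.isOpen isOpen_Ioi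
  refine ⟨φ.source ∩ φ ⁻¹' (φ.target ∩ F ⁻¹' Set.Ioi 0),
    (continuousOn_extChartAt x₀).isOpen_inter_preimage (isOpen_extChartAt_source x₀) hFo,
    ⟨hx₀, φ.map_source hx₀, ?_⟩,
    fun x ↦ (SignType.sign (Ω x (chartFrame x₀ x a) (chartFrame x₀ x b)) : ℝ) • Ω x, ?_, ?_⟩
  · rw [Set.mem_preimage, hF x₀ hx₀, Set.mem_Ioi]
    refine mul_self_pos.2 ?_
    simpa only [a, b, chartFrame_chartD hx₀] using hef
  · refine BilinField.smoothOn_of_contDiffAt_inChart (x₀ := x₀)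
      ((continuousOn_extChartAt x₀).isOpen_inter_preimage (isOpen_extChartAt_source x₀) hFo)
      (fun x hx ↦ by rw [← extChartAt_source (𝓡 n)]; exact hx.1) ?_
    rintro x ⟨hxs, hxt, hxF⟩
    refine LocalMetric.contDiffAt_clm_iff.2 fun u ↦ LocalMetric.contDiffAt_clm_iff.2 fun v ↦ ?_
    -- With `k = Ω(a, b)`, the normalized form is `sign(k) Ω = k Ω / |k| = ε W(a, b, ·, ·) / √F`, an
    -- expression in smooth quantities with `F > 0`.
    have hsm : ContDiffAt ℝ ∞
        (fun y ↦ ε * LocalMetric.weyl G y a b u v / Real.sqrt (F y)) (φ x) :=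
      (contDiffAt_const.mul (hG.contDiffAt_weyl hxt _ _ _ _)).div
        ((hFd _ hxt).sqrt (ne_of_gt hxF)) (Real.sqrt_pos.2 hxF).ne'
    refine hsm.congr_of_eventuallyEq ?_
    filter_upwards [hFo.mem_nhds ⟨hxt, hxF⟩] with y hy
    obtain ⟨hyt, hyF⟩ := hy
    obtain ⟨p, hp, rfl⟩ := φ.surjOn hyt
    rw [Set.mem_preimage, hF p hp, Set.mem_Ioi] at hyF
    rw [BilinField.inChart_apply _ hp, hWl p hp, hF p hp, Real.sqrt_mul_self_eq_abs]
    set k := Ω p (chartFrame x₀ p a) (chartFrame x₀ p b)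
    have hk : k ≠ 0 := mul_self_pos.1 hyF
    have hs : (SignType.sign k : ℝ) * |k| = k := sign_mul_abs k
    rw [eq_div_iff (abs_ne_zero.2 hk)]
    change (SignType.sign k : ℝ) * Ω p (chartFrame x₀ p u) (chartFrame x₀ p v) * |k| = _
    linear_combination Ω p (chartFrame x₀ p u) (chartFrame x₀ p v) * hs
      - k * Ω p (chartFrame x₀ p u) (chartFrame x₀ p v) * hεε
  · rintro x ⟨hxs, hxt, hxF⟩
    rw [Set.mem_preimage, hF x hxs, Set.mem_Ioi] at hxF
    rcases (mul_self_pos.1 hxF).lt_or_gt with h | h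
    · right; simp [h]
    · left; simp [h]

theorem IsWeylSquareRoot.mem_olszak_iff {ε : ℝ} {Ω : BilinField n M} (hε : ε = 1 ∨ ε = -1)
    (h : g.IsWeylSquareRoot ε Ω) (x : M) (w : TangentSpace (𝓡 n) x) :
    w ∈ g.olszak x ↔ ∃ u, g.val x w = Ω x u :=
  (wedge_eq_zero_iff_mem_image (h.1.1 x) (h.2.1 x)
    (by rcases hε with rfl | rfl <;> norm_num) (h.2.2 x) w).symm

end PseudoRiemannianMetric

end

theorem mainTheorem7 {n : ℕ} (hn : 4 ≤ n) {M : Type*} [TopologicalSpace M] [T2Space M]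
    [SecondCountableTopology M] [ConnectedSpace M] [ChartedSpace (Coord n) M]
    [IsManifold (𝓡 n) ∞ M] (g : PseudoRiemannianMetric n M) (hW : g.HasParallelWeyl) :
    (g.OlszakDimEq 2 ↔
      ∃ (ε : ℝ) (Ω : BilinField n M), (ε = 1 ∨ ε = -1) ∧ g.IsWeylSquareRoot ε Ω) ∧
    ∀ (ε : ℝ) (Ω : BilinField n M), (ε = 1 ∨ ε = -1) → g.IsWeylSquareRoot ε Ω →
      (∀ x, g.image Ω x = g.olszak x) ∧
      ∀ (ε' : ℝ) (Ω' : BilinField n M), (ε' = 1 ∨ ε' = -1) → g.IsWeylSquareRoot ε' Ω' →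
        ε' = ε ∧ ∀ x, Ω' x = Ω x ∨ Ω' x = -Ω x := by
  refine ⟨⟨fun hD ↦ ?_, ?_⟩, ?_⟩
  · obtain ⟨ε, hε, hx⟩ := PseudoRiemannianMetric.exists_global_sign hn hD
    -- The roots are picked independently at each point; their uncontrolled signs are allowed by the
    -- notion of a form up to sign.
    choose Ω hΩ hr hΩW using hx
    have hε0 : ε ≠ 0 := by rcases hε with rfl | rfl <;> norm_num
    refine ⟨ε, Ω, hε, ⟨hΩ, fun x₀ ↦ ?_⟩, hr, hΩW⟩
    obtain ⟨U, hU, hxU, η, hη, hs⟩ :=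
      PseudoRiemannianMetric.exists_smooth_sign_change hε hr hΩW x₀
    refine ⟨U, hU, hxU, η, hη, ?_, hs⟩
    refine PseudoRiemannianMetric.isParallelOn_of_weylAt_eq hW hε0 hU hη ?_ ?_
    · intro x hx u v w z
      rw [hΩW]
      rcases hs x hx with h | h <;> simp [h]
    · intro x hx h0
      obtain ⟨e, f, hef⟩ := exists_apply_ne_zero_of_finrank_range (hr x)
      rcases hs x hx with h | h <;> exact hef (by simp [h, h0])
  · rintro ⟨ε, Ω, hε, h⟩ x
    exact finrank_eq_two_of_mem_iff (g.nondegenerate x) (h.2.1 x) (h.mem_olszak_iff hε x)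
  · intro ε Ω hε h
    refine ⟨fun x ↦ Submodule.ext fun w ↦ (h.mem_olszak_iff hε x w).symm, ?_⟩
    intro ε' Ω' hε' h'
    have key : ∀ x, ε' = ε ∧ (Ω' x = Ω x ∨ Ω' x = -Ω x) := by
      intro x
      obtain ⟨e, f, hef⟩ := exists_apply_ne_zero_of_finrank_range (h.2.1 x)
      exact square_root_unique hε hε' hef fun u v w z ↦ by rw [← h.2.2, ← h'.2.2]
    -- Equality of the constants `ε'` and `ε` is read off at a single point, which exists because a
    -- connected space is nonempty.
    obtain ⟨x⟩ := (inferInstance : Nonempty M)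
    exact ⟨(key x).1, fun x ↦ (key x).2⟩

end
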